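/- Let $n\ge 1$ and $1\le k\le n$ be integers, and let $p>1$, $\beta<p-1$, $\alpha$ and $d\ge 0$ be real numbers. Put $f(t)=t^d$ for $t>0$ and $f(t)=0$ for $t\le 0$. For $\lambda=(\lambda_1,\dots,\lambda_n)\in\mathbb R^n$ let $$S_k(\lambda)=\sum_{i_1<\dots<i_k}\lambda_{i_1}\cdots\lambda_{i_k},\qquad \Pi_k(\lambda)=\prod_{i_1<\dots<i_k}(\lambda_{i_1}+\dots+\lambda_{i_k}),$$ $$\Gamma_k=\{\lambda: S_i(\lambda)>0,\ i=1,\dots,k\},\qquad \mathcal P_k=\{\lambda:\lambda_{i_1}+\dots+\lambda_{i_k}>0 \text{ for all } i_1<\dots<i_k\},$$ and apply $S_k$, $\Pi_k$ to a matrix through its eigenvalues $\lambda(\cdot)$. Consider in $\mathbb R^n$ the equations $$(1)\quad S_k^{1/k}[D(|Du|^{p-2}Du)]=|x|^\alpha|Du|^\beta f(u),\qquad (2)\quad \Pi_k^{1/\binom nk}[D(|Du|^{p-2}Du)]=|x|^\alpha|Du|^\beta f(u).$$ An *entire admissible subsolution* of (1) (resp. (2)) is a function $u\in C^1(\mathbb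 R^n)\cap C^2(\mathbb R^n\setminus\{0\})$ such that: * if $p\le\alpha+\beta+2$, then $u\in C^2(\mathbb R^n)$; if $p>\alpha+\beta+2$ and $(p-1)\alpha+\beta\ge 0$, then $u\in W^{2,\delta}_{loc}(\mathbb R^n)$ for all $\delta\in\bigl(1,\frac{p-\beta-1}{p-\alpha-\beta-2}\bigr)$; * the field $|Du|^{p-2}Du$ (equal to $0$ where $Du=0$) is $C^1$ on $\mathbb R^n\setminus\{0\}$, and on $\mathbb R^n$ if $(p-1)\alpha+\beta\ge 0$; * at every $x\ne 0$, and also at $x=0$ if $\alpha=\beta=0$, one has $\lambda(D(|Du|^{p-2}Du))\in\Gamma_k$ (resp. $\in\mathcal P_k$), and the left-hand side of the equation is $\ge|x|^\alpha|Du|^\beta f(u)$, where for $\beta<0$ the right-hand side counts as $+\infty$ if $x\neq 0$, $Du(x)=0$ and $f(u(x))>0$. Put $c=\frac1k-1$ for equation (1) and $c=\frac kn-1$ for equation (2), and assume that one of the following holds: * $\alpha\ge c$, and either $p\le\alpha+\beta+2$, or $p>\alpha+\beta+2$ and $(p-1)\alpha+\beta\ge0$; * $-1<\alpha<c$. Then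 equation (1) (resp. (2)) has an entire admissible subsolution $u$ with $u\ge 0$ and $u\not\equiv 0$ if and only if $$d\le p-\beta-1.$$ -/

import Mathlib

open MeasureTheory
open scoped ContDiff

noncomputable section

namespace HessianSub

/-- Euclidean space `ℝⁿ`. -/
abbrev E (n : ℕ) : Type := EuclideanSpace ℝ (Fin n)

/-- The `p`-gradient field `|Du|^{p-2} Du`; it vanishes at the critical points of `u`
(the continuous value there, since `p > 1`). -/
def pGrad {n : ℕ} (p : ℝ) (u : E n → ℝ) (x : E n) : E n :=
  ‖gradient u x‖ ^ (p - 2) • gradient u x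

/-- `λ(D(|Du|^{p-2}Du))(x)`: the real eigenvalues of the derivative at `x` of the `p`-gradient
field, with algebraic multiplicity. All `n` eigenvalues are real iff this multiset
has `n` elements. -/
def pHessEigenvalues {n : ℕ} (p : ℝ) (u : E n → ℝ) (x : E n) : Multiset ℝ :=
  (LinearMap.charpoly (fderiv ℝ (pGrad p u) x : E n →ₗ[ℝ] E n)).roots

/-- The Gårding cone `Γ_k` (of unordered `n`-tuples): `S_i(λ) > 0` for `i = 1, …, k`,
where `S_i` is the `i`-th elementary symmetric polynomial. -/
def gardingCone (n k : ℕ) : Set (Multiset ℝ) :=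
  {l | Multiset.card l = n ∧ ∀ i : ℕ, 1 ≤ i → i ≤ k → 0 < l.esymm i}

/-- The cone `P_k` (of unordered `n`-tuples): all sums of `k` entries (with distinct indices)
are positive. -/
def sumCone (n k : ℕ) : Set (Multiset ℝ) :=
  {l | Multiset.card l = n ∧ ∀ s ∈ l.powersetCard k, 0 < s.sum}

/-- The normalized `k`-Hessian operator `S_k(λ)^{1/k}`. -/
def hessOp (k : ℕ) (l : Multiset ℝ) : ℝ :=
  l.esymm k ^ (1 / (k : ℝ))

/-- The normalized `Π_k`-Hessian operator `Π_k(λ)^{1/C_n^k}`, where `Π_k(λ)` is the product of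
all sums of `k` entries with distinct indices. -/
def piOp (n k : ℕ) (l : Multiset ℝ) : ℝ :=
  ((l.powersetCard k).map Multiset.sum).prod ^ (1 / (n.choose k : ℝ))

/-- `u ∈ L^δ_loc(ℝⁿ)`. -/
def MemLpLoc {n : ℕ} (u : E n → ℝ) (δ : ℝ) : Prop :=
  ∀ K : Set (E n), IsCompact K → MemLp u (ENNReal.ofReal δ) (volume.restrict K)

/-- `w` is the weak partial derivative `∂_i u` on `ℝⁿ`, for locally integrable `u`, `w`. -/
def IsWeakPartial {n : ℕ} (i : Fin n) (u w : E n → ℝ) : Prop :=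
  ∀ φ : E n → ℝ, ContDiff ℝ ∞ φ → HasCompactSupport φ →
    ∫ x, u x * fderiv ℝ φ x (EuclideanSpace.single i 1) = - ∫ x, w x * φ x

/-- `u ∈ W^{2,δ}_loc(ℝⁿ)` (used for `δ > 1`). -/
def MemW2Loc {n : ℕ} (u : E n → ℝ) (δ : ℝ) : Prop :=
  MemLpLoc u δ ∧
  ∃ (g : Fin n → E n → ℝ) (h : Fin n → Fin n → E n → ℝ),
    (∀ i, MemLpLoc (g i) δ ∧ IsWeakPartial i u (g i)) ∧
    (∀ i j, MemLpLoc (h i j) δ ∧ IsWeakPartial j (g i) (h i j))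

/-- The power nonlinearity: `t^d` for `t > 0`, and `0` for `t ≤ 0`. -/
def powerNonlin (d t : ℝ) : ℝ := if 0 < t then t ^ d else 0

/-- The regularity class of entire subsolutions, depending on `p, α, β`. -/
structure EntireRegularity {n : ℕ} (p α β : ℝ) (u : E n → ℝ) : Prop where
  contDiff_one : ContDiff ℝ 1 u
  contDiffOn_two : ContDiffOn ℝ 2 u {0}ᶜ
  contDiff_two : p ≤ α + β + 2 → ContDiff ℝ 2 u
  sobolev : α + β + 2 < p → 0 ≤ (p - 1) * α + β →
    ∀ δ : ℝ, 1 < δ → δ < (p - β - 1) / (p - α - β - 2) → MemW2Loc u δ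
  pGrad_contDiffOn : ContDiffOn ℝ 1 (pGrad p u) {0}ᶜ
  pGrad_contDiff : 0 ≤ (p - 1) * α + β → ContDiff ℝ 1 (pGrad p u)

/-- `u` is an entire admissible subsolution of
`F(λ(D(|Du|^{p-2}Du))) = |x|^α |Du|^β f(u)` in `ℝⁿ`, admissible meaning that the
eigenvalues lie in `cone`. If `(α, β) ≠ (0, 0)`, the equation is degenerate or singular
at the origin, and there only the regularity is required. The field `rhs_finite` makes the
convention `0^β = +∞` for `β < 0` explicit: a subsolution has no critical point
where `f(u) > 0` in this case. -/
structure IsEntireAdmissibleSubsolution {n : ℕ} (p α β : ℝ) (f : ℝ → ℝ)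
    (cone : Set (Multiset ℝ)) (F : Multiset ℝ → ℝ) (u : E n → ℝ) : Prop where
  regular : EntireRegularity p α β u
  admissible : ∀ x : E n, (x ≠ 0 ∨ (α = 0 ∧ β = 0)) → pHessEigenvalues p u x ∈ cone
  rhs_finite : ∀ x : E n, x ≠ 0 → β < 0 → 0 < f (u x) → gradient u x ≠ 0
  subsolution : ∀ x : E n, (x ≠ 0 ∨ (α = 0 ∧ β = 0)) →
    ‖x‖ ^ α * ‖gradient u x‖ ^ β * f (u x) ≤ F (pHessEigenvalues p u x)

/-- Existence of a nonnegative nontrivial (not identically zero) entire admissible subsolution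
in `ℝⁿ`. -/
def HasNonnegNontrivialSubsolution (n : ℕ) (p α β : ℝ) (f : ℝ → ℝ)
    (cone : Set (Multiset ℝ)) (F : Multiset ℝ → ℝ) : Prop :=
  ∃ u : E n → ℝ, IsEntireAdmissibleSubsolution p α β f cone F u ∧
    (∀ x, 0 ≤ u x) ∧ ∃ x, u x ≠ 0

/-- The conditions on `α, β, p` (beyond `p > 1` and `β < p - 1`), with threshold exponent
`c`: either `α ≥ c` together with one of the two alternatives
`p ≤ α + β + 2`, or `p > α + β + 2` and `(p - 1)α + β ≥ 0`; or `-1 < α < c`. -/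
def ExponentCondition (c p α β : ℝ) : Prop :=
  (c ≤ α ∧ (p ≤ α + β + 2 ∨ (α + β + 2 < p ∧ 0 ≤ (p - 1) * α + β))) ∨ (-1 < α ∧ α < c)

end HessianSub

end

/-!
Both `S_k^{1/k}` on `Γ_k` and `Π_k^{1/C_n^k}` on `P_k` are dominated by a multiple of the trace and
dominate the least eigenvalue when that is positive; nothing else about them matters.

Domination by the trace turns a subsolution into a function `u` with positive `p`-Laplacian `Δ_p u`
and `|x|^α |Du|^β u^d ≤ C Δ_p u` where `u > 0`. If `d > p - β - 1`, comparison with a radial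
supersolution which blows up on the sphere of radius `|y| / 2` about `y` gives a Keller–Osserman
bound for `u y` by a negative power of `|y|`. So `u`, if nonnegative and nontrivial, has a maximum,
contradicting the strict maximum principle. At a critical point of `u` second-order comparison is
not available; there positivity of `Δ_p u` forces `u` to grow like `t^{p/(p-1)}` along some ray,
faster than the test function.

If `d ≤ p - β - 1`, an explicit subsolution is `exp (a |x|^μ)` with `μ - 1 = (α + 1) / (p - β - 1)`
and `a` large: this `μ` balances the powers of `|x|`, and `u ≥ 1` absorbs `u^d`.
-/

noncomputable section

open Filter Set Topology

namespace HessianSub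

section Multiset

variable {M : ℝ} {l : Multiset ℝ}

theorem pow_card_le_prod_of_forall_le (hM : 0 ≤ M) (h : ∀ x ∈ l, M ≤ x) :
    M ^ Multiset.card l ≤ l.prod := by
  simpa using Multiset.prod_map_le_prod_map₀ (fun _ ↦ M) id (fun _ _ ↦ hM) h

theorem prod_le_pow_card_of_forall_abs_le (h : ∀ x ∈ l, |x| ≤ M) :
    l.prod ≤ M ^ Multiset.card l :=
  calc l.prod ≤ |l.prod| := le_abs_self _
    _ = (l.map absHom).prod := map_multiset_prod absHom l
    _ ≤ M ^ Multiset.card l := Multiset.prod_map_le_pow_card (fun _ _ ↦ abs_nonneg _) h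

theorem esymm_one_eq_sum {R : Type*} [CommSemiring R] (s : Multiset R) : s.esymm 1 = s.sum := by
  simp [Multiset.esymm, Multiset.powersetCard_one]

theorem esymm_two_cons {R : Type*} [CommSemiring R] (a : R) (s : Multiset R) :
    (a ::ₘ s).esymm 2 = s.esymm 2 + a * s.sum := by
  have h := Multiset.sum_map_mul_left (s := s) (a := a) (f := id)
  simp only [id, Multiset.map_id'] at h
  simp [Multiset.esymm, Multiset.powersetCard_cons, Multiset.powersetCard_one, h]

theorem sum_sq_add_two_mul_esymm_two {R : Type*} [CommSemiring R] (s : Multiset R) :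
    (s.map (· ^ 2)).sum + 2 * s.esymm 2 = s.sum ^ 2 := by
  induction s using Multiset.induction with
  | empty => simp [Multiset.esymm, Multiset.powersetCard_zero_right 1]
  | cons a s ih =>
    rw [esymm_two_cons, Multiset.map_cons, Multiset.sum_cons, Multiset.sum_cons, add_sq, ← ih]
    ring

theorem abs_le_sum_of_esymm_two_nonneg (hsum : 0 ≤ l.sum) (hl : 0 ≤ l.esymm 2) {x : ℝ}
    (hx : x ∈ l) : |x| ≤ l.sum := by
  have hx_sq : x ^ 2 ≤ (l.map (· ^ 2)).sum :=
    Multiset.single_le_sum (Multiset.forall_mem_map_iff.2 fun y _ ↦ sq_nonneg y) _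
      (Multiset.mem_map_of_mem (· ^ 2) hx)
  exact abs_le_of_sq_le_sq (by linarith [sum_sq_add_two_mul_esymm_two l]) hsum

theorem esymm_le_of_forall_abs_le (h : ∀ x ∈ l, |x| ≤ M) (k : ℕ) :
    l.esymm k ≤ (Multiset.card l).choose k * M ^ k := by
  have hprod : ∀ x ∈ (l.powersetCard k).map Multiset.prod, x ≤ M ^ k := by
    simp only [Multiset.forall_mem_map_iff, Multiset.mem_powersetCard]
    rintro t ⟨htl, rfl⟩
    exact prod_le_pow_card_of_forall_abs_le fun x hx ↦ h x (Multiset.mem_of_le htl hx)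
  simpa [Multiset.esymm] using Multiset.sum_le_card_nsmul _ _ hprod

theorem choose_mul_pow_le_esymm (hM : 0 ≤ M) (h : ∀ x ∈ l, M ≤ x) (k : ℕ) :
    (Multiset.card l).choose k * M ^ k ≤ l.esymm k := by
  have hprod : ∀ x ∈ (l.powersetCard k).map Multiset.prod, M ^ k ≤ x := by
    simp only [Multiset.forall_mem_map_iff, Multiset.mem_powersetCard]
    rintro t ⟨htl, rfl⟩
    exact pow_card_le_prod_of_forall_le hM fun x hx ↦ h x (Multiset.mem_of_le htl hx)
  simpa [Multiset.esymm] using Multiset.card_nsmul_le_sum hprod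

theorem sum_map_sum_powersetCard_succ {R : Type*} [AddCommMonoid R] (s : Multiset R) (k : ℕ) :
    ((s.powersetCard (k + 1)).map Multiset.sum).sum
      = (Multiset.card s - 1).choose k • s.sum := by
  induction s using Multiset.induction generalizing k with
  | empty => simp [Multiset.powersetCard_zero_right k]
  | cons a s ih =>
    have hcons : ((s.powersetCard k).map fun t ↦ (a ::ₘ t).sum).sum
        = (Multiset.card s).choose k • a + ((s.powersetCard k).map Multiset.sum).sum := by
      simp
    rw [Multiset.powersetCard_cons, Multiset.map_add, Multiset.sum_add, ih, Multiset.map_map,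
      Function.comp_def, hcons, Multiset.sum_cons, Multiset.card_cons, Nat.add_sub_cancel,
      nsmul_add, add_left_comm]
    congr 1
    obtain hs | hs := Nat.eq_zero_or_pos (Multiset.card s)
    · obtain rfl := Multiset.card_eq_zero.1 hs
      cases k <;> simp [Multiset.powersetCard_zero_right]
    · obtain ⟨m, hm⟩ := Nat.exists_eq_add_of_le' hs
      cases k with
      | zero => simp
      | succ k => rw [ih, hm, Nat.add_sub_cancel, Nat.choose_succ_succ, add_comm, add_nsmul]

end Multiset

section Cones

variable {n k : ℕ} {l : Multiset ℝ} {m : ℝ}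

theorem sum_pos_of_mem_gardingCone (hk : 1 ≤ k) (hl : l ∈ gardingCone n k) : 0 < l.sum :=
  esymm_one_eq_sum l ▸ hl.2 1 le_rfl hk

theorem esymm_le_of_mem_gardingCone (hk : 1 ≤ k) (hl : l ∈ gardingCone n k) :
    l.esymm k ≤ n.choose k * l.sum ^ k := by
  have hsum := sum_pos_of_mem_gardingCone hk hl
  obtain rfl | hk := hk.eq_or_lt
  · have hn : 1 ≤ n := by
      rw [← hl.1, Nat.one_le_iff_ne_zero, Ne, Multiset.card_eq_zero]
      rintro rfl
      simp at hsum
    rw [esymm_one_eq_sum, Nat.choose_one_right, pow_one]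
    exact le_mul_of_one_le_left hsum.le (mod_cast hn)
  · have habs : ∀ x ∈ l, |x| ≤ l.sum := fun x hx ↦
      abs_le_sum_of_esymm_two_nonneg hsum.le (hl.2 2 one_le_two hk).le hx
    simpa only [hl.1] using esymm_le_of_forall_abs_le habs k

theorem hessOp_le_mul_sum (hk : 1 ≤ k) (hl : l ∈ gardingCone n k) :
    hessOp k l ≤ (n.choose k : ℝ) ^ (1 / (k : ℝ)) * l.sum := by
  have hsum := (sum_pos_of_mem_gardingCone hk hl).le
  calc hessOp k l ≤ (n.choose k * l.sum ^ k) ^ (1 / (k : ℝ)) :=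
        Real.rpow_le_rpow (hl.2 k hk le_rfl).le (esymm_le_of_mem_gardingCone hk hl) (by positivity)
    _ = (n.choose k : ℝ) ^ (1 / (k : ℝ)) * l.sum := by
        rw [Real.mul_rpow (by positivity) (by positivity), one_div,
          Real.pow_rpow_inv_natCast hsum (by lia)]

theorem pow_le_esymm (hm : 0 ≤ m) (h : ∀ x ∈ l, m ≤ x) (hk : k ≤ Multiset.card l) :
    m ^ k ≤ l.esymm k :=
  (le_mul_of_one_le_left (by positivity) (mod_cast Nat.choose_pos hk)).trans
    (choose_mul_pow_le_esymm hm h k)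

theorem mem_gardingCone_of_forall_le (hkn : k ≤ n) (hm : 0 < m) (hc : Multiset.card l = n)
    (h : ∀ x ∈ l, m ≤ x) : l ∈ gardingCone n k :=
  ⟨hc, fun _ _ hi ↦ (pow_pos hm _).trans_le (pow_le_esymm hm.le h (hc ▸ hi.trans hkn))⟩

theorem le_hessOp_of_forall_le (hk : 1 ≤ k) (hkl : k ≤ Multiset.card l) (hm : 0 ≤ m)
    (h : ∀ x ∈ l, m ≤ x) : m ≤ hessOp k l :=
  calc m = (m ^ k) ^ (1 / (k : ℝ)) := by rw [one_div, Real.pow_rpow_inv_natCast hm (by lia)]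
    _ ≤ hessOp k l := Real.rpow_le_rpow (by positivity) (pow_le_esymm hm h hkl) (by positivity)

theorem sum_map_sum_powersetCard_of_mem_sumCone (hk : 1 ≤ k) (hl : l ∈ sumCone n k) :
    ((l.powersetCard k).map Multiset.sum).sum = (n - 1).choose (k - 1) * l.sum := by
  have h := sum_map_sum_powersetCard_succ l (k - 1)
  rwa [Nat.sub_add_cancel hk, hl.1, nsmul_eq_mul] at h

theorem pos_of_mem_map_sum_of_mem_sumCone (hl : l ∈ sumCone n k) {x : ℝ}
    (hx : x ∈ (l.powersetCard k).map Multiset.sum) : 0 < x := by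
  obtain ⟨s, hs, rfl⟩ := Multiset.mem_map.1 hx
  exact hl.2 s hs

theorem sum_pos_of_mem_sumCone (hk : 1 ≤ k) (hkn : k ≤ n) (hl : l ∈ sumCone n k) :
    0 < l.sum := by
  set T := (l.powersetCard k).map Multiset.sum
  have hT : 0 < Multiset.card T := by
    simpa only [T, Multiset.card_map, Multiset.card_powersetCard, hl.1] using Nat.choose_pos hkn
  obtain ⟨x, hx⟩ := Multiset.card_pos_iff_exists_mem.1 hT
  have hTsum : 0 < T.sum := (pos_of_mem_map_sum_of_mem_sumCone hl hx).trans_le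
    (Multiset.single_le_sum (fun y hy ↦ (pos_of_mem_map_sum_of_mem_sumCone hl hy).le) x hx)
  rw [sum_map_sum_powersetCard_of_mem_sumCone hk hl] at hTsum
  exact pos_of_mul_pos_right hTsum (by positivity)

theorem piOp_le_mul_sum (hk : 1 ≤ k) (hkn : k ≤ n) (hl : l ∈ sumCone n k) :
    piOp n k l ≤ (n - 1).choose (k - 1) * l.sum := by
  rw [← sum_map_sum_powersetCard_of_mem_sumCone hk hl, piOp]
  set T := (l.powersetCard k).map Multiset.sum with hT
  have hpos : ∀ x ∈ T, 0 ≤ x := fun x hx ↦ (pos_of_mem_map_sum_of_mem_sumCone hl hx).le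
  have hprod : T.prod ≤ T.sum ^ n.choose k := by
    rw [← hl.1, ← Multiset.card_powersetCard, ← Multiset.card_map Multiset.sum, ← hT]
    refine prod_le_pow_card_of_forall_abs_le fun x hx ↦ ?_
    rw [abs_of_nonneg (hpos x hx)]
    exact Multiset.single_le_sum hpos x hx
  calc T.prod ^ (1 / (n.choose k : ℝ)) ≤ (T.sum ^ n.choose k) ^ (1 / (n.choose k : ℝ)) :=
        Real.rpow_le_rpow (Multiset.prod_nonneg hpos) hprod (by positivity)
    _ = T.sum := by
        rw [one_div, Real.pow_rpow_inv_natCast (Multiset.sum_nonneg hpos) (Nat.choose_pos hkn).ne']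

theorem le_sum_of_mem_powersetCard (hk : 1 ≤ k) (hm : 0 ≤ m) (h : ∀ x ∈ l, m ≤ x)
    {s : Multiset ℝ} (hs : s ∈ l.powersetCard k) : m ≤ s.sum := by
  obtain ⟨hsl, rfl⟩ := Multiset.mem_powersetCard.1 hs
  have hsum := Multiset.card_nsmul_le_sum fun x hx ↦ h x (Multiset.mem_of_le hsl hx)
  rw [nsmul_eq_mul] at hsum
  exact (le_mul_of_one_le_left hm (mod_cast hk)).trans hsum

theorem mem_sumCone_of_forall_le (hk : 1 ≤ k) (hm : 0 < m) (hc : Multiset.card l = n)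
    (h : ∀ x ∈ l, m ≤ x) : l ∈ sumCone n k :=
  ⟨hc, fun _ hs ↦ hm.trans_le (le_sum_of_mem_powersetCard hk hm.le h hs)⟩

theorem le_piOp_of_forall_le (hk : 1 ≤ k) (hkn : k ≤ n) (hm : 0 ≤ m)
    (hc : Multiset.card l = n) (h : ∀ x ∈ l, m ≤ x) : m ≤ piOp n k l := by
  have hprod : m ^ n.choose k ≤ ((l.powersetCard k).map Multiset.sum).prod := by
    rw [← hc, ← Multiset.card_powersetCard, ← Multiset.card_map Multiset.sum]
    exact pow_card_le_prod_of_forall_le hm <|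
      Multiset.forall_mem_map_iff.2 fun s hs ↦ le_sum_of_mem_powersetCard hk hm h hs
  calc m = (m ^ n.choose k) ^ (1 / (n.choose k : ℝ)) := by
        rw [one_div, Real.pow_rpow_inv_natCast hm (Nat.choose_pos hkn).ne']
    _ ≤ piOp n k l := Real.rpow_le_rpow (by positivity) hprod (by positivity)

/-- The two properties of an operator `F` on a cone of (unordered) `n`-tuples that decide the
solvability of `F(λ) ≥ |x|^α |Du|^β f(u)`: on the cone `F` is dominated by the trace, and
`n`-tuples with entries at least `m > 0` lie in the cone, with `F ≥ m`. -/
structure IsTraceComparable (n : ℕ) (cone : Set (Multiset ℝ)) (F : Multiset ℝ → ℝ) : Prop where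
  card_eq : ∀ l ∈ cone, Multiset.card l = n
  sum_pos : ∀ l ∈ cone, 0 < l.sum
  exists_le_mul_sum : ∃ C > 0, ∀ l ∈ cone, F l ≤ C * l.sum
  mem_of_forall_le : ∀ m > 0, ∀ l, Multiset.card l = n → (∀ x ∈ l, m ≤ x) → l ∈ cone
  le_of_forall_le : ∀ m > 0, ∀ l, Multiset.card l = n → (∀ x ∈ l, m ≤ x) → m ≤ F l

theorem IsTraceComparable.dim_pos {cone : Set (Multiset ℝ)} {F : Multiset ℝ → ℝ}
    (h : IsTraceComparable n cone F) : 0 < n := by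
  refine Nat.pos_of_ne_zero fun hn ↦ ?_
  simpa using h.sum_pos 0 (h.mem_of_forall_le 1 one_pos 0 (by simp [hn]) (by simp))

theorem isTraceComparable_hessOp (hk : 1 ≤ k) (hkn : k ≤ n) :
    IsTraceComparable n (gardingCone n k) (hessOp k) where
  card_eq _ hl := hl.1
  sum_pos _ hl := sum_pos_of_mem_gardingCone hk hl
  exists_le_mul_sum := ⟨_, Real.rpow_pos_of_pos (mod_cast Nat.choose_pos hkn) _,
    fun _ hl ↦ hessOp_le_mul_sum hk hl⟩
  mem_of_forall_le _ hm _ hc h := mem_gardingCone_of_forall_le hkn hm hc h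
  le_of_forall_le _ hm _ hc h := le_hessOp_of_forall_le hk (hc ▸ hkn) hm.le h

theorem isTraceComparable_piOp (hk : 1 ≤ k) (hkn : k ≤ n) :
    IsTraceComparable n (sumCone n k) (piOp n k) where
  card_eq _ hl := hl.1
  sum_pos _ hl := sum_pos_of_mem_sumCone hk hkn hl
  exists_le_mul_sum := ⟨(n - 1).choose (k - 1),
    mod_cast Nat.choose_pos (Nat.sub_le_sub_right hkn 1), fun _ hl ↦ piOp_le_mul_sum hk hkn hl⟩
  mem_of_forall_le _ hm _ hc h := mem_sumCone_of_forall_le hk hm hc h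
  le_of_forall_le _ hm _ hc h := le_piOp_of_forall_le hk hkn hm.le hc h

end Cones

section Eigenvalues

variable {n : ℕ} {p : ℝ} {u : E n → ℝ} {x : E n}

/-- The `p`-Laplacian `div (|Du|^{p-2} Du)` of `u` at `x`. -/
def pLaplacian (p : ℝ) (u : E n → ℝ) (x : E n) : ℝ :=
  LinearMap.trace ℝ (E n) (fderiv ℝ (pGrad p u) x : E n →ₗ[ℝ] E n)

theorem sum_pHessEigenvalues_eq_pLaplacian (h : Multiset.card (pHessEigenvalues p u x) = n) :
    (pHessEigenvalues p u x).sum = pLaplacian p u x := by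
  refine (Module.End.trace_eq_sum_roots_charpoly_of_splits ?_).symm
  rw [Polynomial.splits_iff_card_roots, LinearMap.charpoly_natDegree, finrank_euclideanSpace_fin]
  exact h

theorem card_pHessEigenvalues_of_isSymmetric
    (hs : (fderiv ℝ (pGrad p u) x : E n →ₗ[ℝ] E n).IsSymmetric) :
    Multiset.card (pHessEigenvalues p u x) = n := by
  have h : pHessEigenvalues p u x = _ :=
    hs.roots_charpoly_eq_eigenvalues finrank_euclideanSpace_fin
  simp [h]

theorem le_of_mem_pHessEigenvalues_of_isSymmetric {m : ℝ}
    (hs : (fderiv ℝ (pGrad p u) x : E n →ₗ[ℝ] E n).IsSymmetric)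
    (hm : ∀ v : E n, m * ‖v‖ ^ 2 ≤ inner ℝ (fderiv ℝ (pGrad p u) x v) v) :
    ∀ y ∈ pHessEigenvalues p u x, m ≤ y := by
  have hn : Module.finrank ℝ (E n) = n := finrank_euclideanSpace_fin
  have h : pHessEigenvalues p u x = _ := hs.roots_charpoly_eq_eigenvalues hn
  simp only [h, Multiset.forall_mem_map_iff]
  intro i _
  have hi := hm (hs.eigenvectorBasis hn i)
  rw [← ContinuousLinearMap.coe_coe, hs.apply_eigenvectorBasis, inner_smul_left,
    real_inner_self_eq_norm_sq, (hs.eigenvectorBasis hn).norm_eq_one] at hi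
  simpa using hi

end Eigenvalues

section Touching

variable {F : Type*} [NormedAddCommGroup F] [InnerProductSpace ℝ F] {x y z e : F} {t : ℝ}

theorem hasDerivAt_add_smul (x e : F) (t : ℝ) : HasDerivAt (fun t : ℝ ↦ x + t • e) e t := by
  simpa using ((hasDerivAt_id t).smul_const e).const_add x

theorem tendsto_add_smul (x e : F) : Tendsto (fun t : ℝ ↦ x + t • e) (𝓝 0) (𝓝 x) := by
  simpa using (hasDerivAt_add_smul x e 0).continuousAt.tendsto

theorem hasDerivAt_comp_add_smul {G : Type*} [NormedAddCommGroup G] [NormedSpace ℝ G] {f : F → G}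
    (hf : DifferentiableAt ℝ f (x + t • e)) :
    HasDerivAt (fun t : ℝ ↦ f (x + t • e)) (fderiv ℝ f (x + t • e) e) t :=
  hf.hasFDerivAt.comp_hasDerivAt t (hasDerivAt_add_smul x e t)

theorem hasDerivAt_norm_add_smul (h : z + t • e ≠ 0) :
    HasDerivAt (fun t : ℝ ↦ ‖z + t • e‖) (inner ℝ (z + t • e) e / ‖z + t • e‖) t := by
  have hsq := (hasDerivAt_add_smul z e t).norm_sq.sqrt (pow_ne_zero 2 (norm_ne_zero_iff.2 h))
  simpa only [Real.sqrt_sq (norm_nonneg _), mul_div_mul_left _ _ (two_ne_zero' ℝ)] using hsq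

theorem hasDerivAt_inner_div_norm_add_smul (hz : z ≠ 0) :
    HasDerivAt (fun t : ℝ ↦ inner ℝ (z + t • e) e / ‖z + t • e‖)
      ((‖e‖ ^ 2 - (inner ℝ z e / ‖z‖) ^ 2) / ‖z‖) 0 := by
  have hz' : ‖z‖ ≠ 0 := norm_ne_zero_iff.2 hz
  have hinner : HasDerivAt (fun t : ℝ ↦ inner ℝ (z + t • e) e) (‖e‖ ^ 2) 0 := by
    simpa using (hasDerivAt_add_smul z e 0).inner ℝ (hasDerivAt_const (0 : ℝ) e)
  have hdiv := hinner.div (hasDerivAt_norm_add_smul (z := z) (e := e) (t := 0) (by simpa))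
    (by simpa)
  simp only [zero_smul, add_zero] at hdiv
  refine hdiv.congr_deriv ?_
  field_simp

theorem second_deriv_nonpos_of_isLocalMax {f f' : ℝ → ℝ} {f'' x₀ : ℝ} (hmax : IsLocalMax f x₀)
    (hf : ∀ᶠ t in 𝓝 x₀, HasDerivAt f (f' t) t) (hf' : HasDerivAt f' f'' x₀) : f'' ≤ 0 := by
  by_contra! hpos
  have hd : deriv f =ᶠ[𝓝 x₀] f' := hf.mono fun _ ht ↦ ht.deriv
  have hdd : deriv (deriv f) x₀ = f'' := by rw [hd.deriv_eq, hf'.deriv]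
  have hmin := isLocalMin_of_deriv_deriv_pos (hdd ▸ hpos) hmax.deriv_eq_zero
    hf.self_of_nhds.continuousAt
  have hconst : f =ᶠ[𝓝 x₀] fun _ ↦ f x₀ := by
    filter_upwards [hmax, hmin] with t hle hge using le_antisymm hle hge
  rw [hconst.deriv.deriv_eq] at hdd
  simp only [deriv_const', deriv_const] at hdd
  exact hpos.ne hdd

theorem isLocalMax_comp_add_smul {f : F → ℝ} (h : IsLocalMax f x) (e : F) :
    IsLocalMax (fun t : ℝ ↦ f (x + t • e)) 0 := by
  filter_upwards [(tendsto_add_smul x e).eventually h] with t ht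
  simpa using ht

variable {φ : ℝ → ℝ}

theorem hasDerivAt_radial_add_smul {φ' : ℝ} (h : x + t • e ≠ y)
    (hφ : HasDerivAt φ φ' ‖x + t • e - y‖) :
    HasDerivAt (fun t : ℝ ↦ φ ‖x + t • e - y‖)
      (φ' * (inner ℝ (x - y + t • e) e / ‖x - y + t • e‖)) t := by
  have hcomm : ∀ t : ℝ, x + t • e - y = x - y + t • e := fun t ↦ add_sub_right_comm x (t • e) y
  simp only [hcomm] at hφ ⊢
  exact hφ.comp t (hasDerivAt_norm_add_smul (by rwa [← hcomm, sub_ne_zero]))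

variable [CompleteSpace F] {u v : F → ℝ}

theorem differentiableAt_gradient (hu : ContDiffAt ℝ 2 u x) : DifferentiableAt ℝ (gradient u) x :=
  (InnerProductSpace.toDual ℝ F).symm.differentiable.differentiableAt.comp x <|
    (hu.fderiv_right (m := 1) (by norm_num)).differentiableAt one_ne_zero

theorem inner_gradient_eq_of_isLocalMax_sub {v' : ℝ} (hu : DifferentiableAt ℝ u x)
    (hv : HasDerivAt (fun t : ℝ ↦ v (x + t • e)) v' 0)
    (hmax : IsLocalMax (fun z ↦ u z - v z) x) : inner ℝ (gradient u x) e = v' := by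
  have hu' := hasDerivAt_comp_add_smul (x := x) (e := e) (t := 0) (by simpa using hu)
  have h := (isLocalMax_comp_add_smul hmax e).hasDerivAt_eq_zero (hu'.sub hv)
  rw [inner_gradient_left]
  simpa only [zero_smul, add_zero, sub_eq_zero] using h

theorem inner_fderiv_gradient_le_of_isLocalMax_sub {v' : ℝ → ℝ} {v'' : ℝ}
    (hu : ContDiffAt ℝ 2 u x)
    (hv : ∀ᶠ t : ℝ in 𝓝 0, HasDerivAt (fun t : ℝ ↦ v (x + t • e)) (v' t) t)
    (hv' : HasDerivAt v' v'' 0) (hmax : IsLocalMax (fun z ↦ u z - v z) x) :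
    inner ℝ (fderiv ℝ (gradient u) x e) e ≤ v'' := by
  have hu_ev : ∀ᶠ z in 𝓝 x, DifferentiableAt ℝ u z :=
    (hu.eventually (by simp)).mono fun z hz ↦ hz.differentiableAt two_ne_zero
  have hd : ∀ᶠ t : ℝ in 𝓝 0, HasDerivAt (fun t : ℝ ↦ u (x + t • e) - v (x + t • e))
      (inner ℝ (gradient u (x + t • e)) e - v' t) t := by
    filter_upwards [(tendsto_add_smul x e).eventually hu_ev, hv] with t hut hvt
    rw [inner_gradient_left]
    exact (hasDerivAt_comp_add_smul hut).sub hvt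
  have hgrad : HasDerivAt (fun t : ℝ ↦ inner ℝ (gradient u (x + t • e)) e)
      (inner ℝ (fderiv ℝ (gradient u) x e) e) 0 := by
    have h := hasDerivAt_comp_add_smul (x := x) (e := e) (t := 0)
      (by simpa using differentiableAt_gradient hu)
    simpa using h.inner ℝ (hasDerivAt_const (0 : ℝ) e)
  exact sub_nonpos.1 <| second_deriv_nonpos_of_isLocalMax (isLocalMax_comp_add_smul hmax e) hd
    (hgrad.sub hv')

theorem gradient_eq_of_isLocalMax_sub_radial {φ' : ℝ} (hxy : x ≠ y) (hu : DifferentiableAt ℝ u x)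
    (hφ : HasDerivAt φ φ' ‖x - y‖) (hmax : IsLocalMax (fun z ↦ u z - φ ‖z - y‖) x) :
    gradient u x = (φ' / ‖x - y‖) • (x - y) := by
  refine ext_inner_right ℝ fun e ↦ ?_
  have hv := hasDerivAt_radial_add_smul (x := x) (y := y) (e := e) (t := 0) (φ := φ) (φ' := φ')
    (by simpa) (by simpa)
  rw [inner_gradient_eq_of_isLocalMax_sub hu hv hmax, zero_smul, add_zero, real_inner_smul_left]
  ring

theorem inner_fderiv_gradient_le_of_isLocalMax_sub_radial {φ' : ℝ → ℝ} {φ'' : ℝ} (hxy : x ≠ y)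
    (hu : ContDiffAt ℝ 2 u x) (hφ : ∀ᶠ r in 𝓝 ‖x - y‖, HasDerivAt φ (φ' r) r)
    (hφ' : HasDerivAt φ' φ'' ‖x - y‖) (hmax : IsLocalMax (fun z ↦ u z - φ ‖z - y‖) x) (e : F) :
    inner ℝ (fderiv ℝ (gradient u) x e) e ≤
      φ'' * (inner ℝ (x - y) e / ‖x - y‖) ^ 2
        + φ' ‖x - y‖ * ((‖e‖ ^ 2 - (inner ℝ (x - y) e / ‖x - y‖) ^ 2) / ‖x - y‖) := by
  have hxy' : x - y ≠ 0 := sub_ne_zero.2 hxy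
  have htend : Tendsto (fun t : ℝ ↦ ‖x + t • e - y‖) (𝓝 0) (𝓝 ‖x - y‖) :=
    ((tendsto_add_smul x e).sub_const y).norm
  have hv : ∀ᶠ t : ℝ in 𝓝 0, HasDerivAt (fun t : ℝ ↦ φ ‖x + t • e - y‖)
      (φ' ‖x - y + t • e‖ * (inner ℝ (x - y + t • e) e / ‖x - y + t • e‖)) t := by
    filter_upwards [(tendsto_add_smul x e).eventually_ne hxy, htend.eventually hφ] with t hne ht
    have h := hasDerivAt_radial_add_smul hne ht
    rwa [add_sub_right_comm] at h
  have hv' := (hφ'.comp_of_eq 0 (hasDerivAt_norm_add_smul (e := e) (t := 0) (by simpa))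
    (by simp)).mul (hasDerivAt_inner_div_norm_add_smul (e := e) hxy')
  refine (inner_fderiv_gradient_le_of_isLocalMax_sub hu hv hv' hmax).trans_eq ?_
  simp only [Function.comp_apply, zero_smul, add_zero]
  ring

end Touching

section PLaplacian

variable {n : ℕ} {p : ℝ} {u : E n → ℝ} {x y : E n}

theorem hasFDerivAt_norm_rpow_of_ne {F : Type*} [NormedAddCommGroup F] [InnerProductSpace ℝ F]
    {x : F} (hx : x ≠ 0) (s : ℝ) :
    HasFDerivAt (fun x : F ↦ ‖x‖ ^ s) ((s * ‖x‖ ^ (s - 2)) • innerSL ℝ x) x := by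
  apply HasStrictFDerivAt.hasFDerivAt
  convert! (hasStrictFDerivAt_norm_sq x).rpow_const (p := s / 2) (by simp [hx]) using 0
  simp_rw [← Real.rpow_natCast_mul (norm_nonneg _), ← Nat.cast_smul_eq_nsmul ℝ, smul_smul]
  ring_nf

theorem exists_orthonormalBasis_apply_eq (i₀ : Fin n) {ν : E n} (hν : ‖ν‖ = 1) :
    ∃ b : OrthonormalBasis (Fin n) ℝ (E n), b i₀ = ν := by
  have horth : Orthonormal ℝ (({i₀} : Set (Fin n)).domRestrict fun _ ↦ ν) := by
    rw [orthonormal_iff_ite]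
    rintro ⟨i, rfl⟩ ⟨j, rfl⟩
    simp [Set.domRestrict, hν]
  obtain ⟨b, hb⟩ := horth.exists_orthonormalBasis_extension_of_card_eq (by simp)
  exact ⟨b, hb i₀ rfl⟩

theorem trace_le_of_inner_le {H : E n →L[ℝ] E n} {ν : E n} {B : ℝ} (hν : ‖ν‖ = 1)
    (hB : ∀ e, ‖e‖ = 1 → inner ℝ ν e = 0 → inner ℝ (H e) e ≤ B) :
    LinearMap.trace ℝ (E n) H ≤ inner ℝ (H ν) ν + (n - 1) * B := by
  obtain rfl | hn := Nat.eq_zero_or_pos n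
  · simp [Subsingleton.elim ν 0] at hν
  obtain ⟨b, hb⟩ := exists_orthonormalBasis_apply_eq ⟨0, hn⟩ hν
  have hsum : ∑ i ∈ Finset.univ.erase ⟨0, hn⟩, inner ℝ (b i) (H (b i)) ≤ (n - 1) * B := by
    calc _ ≤ ∑ _ ∈ Finset.univ.erase (⟨0, hn⟩ : Fin n), B := Finset.sum_le_sum fun _ hi ↦ by
          rw [real_inner_comm]
          exact hB _ (b.norm_eq_one _) (hb ▸ b.inner_eq_zero (Finset.ne_of_mem_erase hi).symm)
      _ = (n - 1) * B := by simp [Finset.card_erase_of_mem, Nat.cast_pred hn]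
  rw [LinearMap.trace_eq_sum_inner _ b, ← Finset.add_sum_erase _ _ (Finset.mem_univ ⟨0, hn⟩), hb,
    real_inner_comm]
  exact add_le_add_right hsum _

theorem hasFDerivAt_pGrad {H : E n →L[ℝ] E n} (hH : HasFDerivAt (gradient u) H x)
    (h0 : gradient u x ≠ 0) :
    HasFDerivAt (pGrad p u) (‖gradient u x‖ ^ (p - 2) • H +
      (((p - 2) * ‖gradient u x‖ ^ (p - 2 - 2)) •
        (innerSL ℝ (gradient u x)).comp H).smulRight (gradient u x)) x :=
  ((hasFDerivAt_norm_rpow_of_ne h0 (p - 2)).comp x hH).smul hH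

theorem pLaplacian_eq_trace_add {ν : E n} {τ : ℝ} (hu : ContDiffAt ℝ 2 u x) (hτ : τ ≠ 0)
    (hν : ‖ν‖ = 1) (hgrad : gradient u x = τ • ν) :
    pLaplacian p u x = |τ| ^ (p - 2) *
      (LinearMap.trace ℝ (E n) (fderiv ℝ (gradient u) x : E n →ₗ[ℝ] E n)
        + (p - 2) * inner ℝ (fderiv ℝ (gradient u) x ν) ν) := by
  have hnorm : ‖gradient u x‖ = |τ| := by rw [hgrad, norm_smul, hν, mul_one, Real.norm_eq_abs]
  have hν0 : ν ≠ 0 := norm_ne_zero_iff.1 (by simp [hν])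
  have hpow : |τ| ^ (p - 2) = |τ| ^ (p - 2 - 2) * τ ^ 2 := by
    rw [← sq_abs, ← Real.rpow_natCast, ← Real.rpow_add (abs_pos.2 hτ)]
    norm_num
  have hfd := hasFDerivAt_pGrad (p := p) (differentiableAt_gradient hu).hasFDerivAt
    (hgrad ▸ smul_ne_zero hτ hν0)
  have htrace : ∀ (L : E n →L[ℝ] ℝ) (g : E n),
      LinearMap.trace ℝ (E n) (L.smulRight g : E n →ₗ[ℝ] E n) = L g :=
    fun L g ↦ LinearMap.trace_smulRight (L : E n →ₗ[ℝ] ℝ) g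
  rw [pLaplacian, hfd.fderiv, ContinuousLinearMap.toLinearMap_add, map_add,
    ContinuousLinearMap.toLinearMap_smul, map_smul, htrace, hnorm, smul_apply,
    ContinuousLinearMap.comp_apply, hgrad, innerSL_apply_apply, map_smul,
    real_inner_smul_left, real_inner_smul_right, real_inner_comm, smul_eq_mul, smul_eq_mul, hpow]
  ring

theorem pLaplacian_le_of_isLocalMax_sub_radial {φ φ' : ℝ → ℝ} {φ'' : ℝ} (hp : 1 ≤ p) (hxy : x ≠ y)
    (hu : ContDiffAt ℝ 2 u x) (hφ : ∀ᶠ r in 𝓝 ‖x - y‖, HasDerivAt φ (φ' r) r)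
    (hφ' : HasDerivAt φ' φ'' ‖x - y‖) (hne : φ' ‖x - y‖ ≠ 0)
    (hmax : IsLocalMax (fun z ↦ u z - φ ‖z - y‖) x) :
    pLaplacian p u x ≤ |φ' ‖x - y‖| ^ (p - 2) *
      ((p - 1) * φ'' + (n - 1) * (φ' ‖x - y‖ / ‖x - y‖)) := by
  set r := ‖x - y‖
  have hr : r ≠ 0 := norm_ne_zero_iff.2 (sub_ne_zero.2 hxy)
  set ν := r⁻¹ • (x - y) with hν_def
  have hν : ‖ν‖ = 1 := by rw [norm_smul, norm_inv, norm_norm, inv_mul_cancel₀ hr]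
  have hgrad : gradient u x = φ' r • ν := by
    rw [gradient_eq_of_isLocalMax_sub_radial hxy (hu.differentiableAt two_ne_zero)
      hφ.self_of_nhds hmax, hν_def, smul_smul, div_eq_mul_inv]
  have hinner : ∀ e, inner ℝ (x - y) e / r = inner ℝ ν e := fun e ↦ by
    rw [hν_def, real_inner_smul_left, div_eq_inv_mul]
  have hquad (e : E n) : inner ℝ (fderiv ℝ (gradient u) x e) e ≤
      φ'' * inner ℝ ν e ^ 2 + φ' r * ((‖e‖ ^ 2 - inner ℝ ν e ^ 2) / r) := by
    rw [← hinner]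
    exact inner_fderiv_gradient_le_of_isLocalMax_sub_radial hxy hu hφ hφ' hmax e
  have hradial : inner ℝ (fderiv ℝ (gradient u) x ν) ν ≤ φ'' := by
    simpa [real_inner_self_eq_norm_sq, hν] using hquad ν
  have htrace := trace_le_of_inner_le (H := fderiv ℝ (gradient u) x) (B := φ' r / r) hν
    fun e he hνe ↦ by simpa [he, hνe, div_eq_mul_inv] using hquad e
  rw [pLaplacian_eq_trace_add hu hne hν hgrad]
  refine mul_le_mul_of_nonneg_left ?_ (by positivity)
  linarith [mul_le_mul_of_nonneg_left hradial (sub_nonneg.2 hp)]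

end PLaplacian

section CriticalGrowth

variable {n : ℕ} {p : ℝ} {u v : E n → ℝ} {x e : E n}

theorem exists_inner_pos_of_trace_pos {H : E n →L[ℝ] E n}
    (hH : 0 < LinearMap.trace ℝ (E n) H) : ∃ e, 0 < inner ℝ (H e) e := by
  rw [LinearMap.trace_eq_sum_inner _ (EuclideanSpace.basisFun (Fin n) ℝ),
    ← Finset.sum_const_zero (ι := Fin n) (s := Finset.univ)] at hH
  obtain ⟨i, -, hi⟩ := Finset.exists_lt_of_sum_lt hH
  rw [real_inner_comm] at hi
  exact ⟨_, hi⟩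

theorem norm_rpow_smul_norm_rpow_smul {F : Type*} [NormedAddCommGroup F] [NormedSpace ℝ F]
    (hp : p ≠ 1) (G : F) :
    ‖‖G‖ ^ (p - 2) • G‖ ^ ((2 - p) / (p - 1)) • ‖G‖ ^ (p - 2) • G = G := by
  obtain rfl | hG := eq_or_ne G 0
  · simp
  have hG' : 0 < ‖G‖ := norm_pos_iff.2 hG
  have hexp : (p - 2 + 1) * ((2 - p) / (p - 1)) + (p - 2) = 0 := by
    have : p - 1 ≠ 0 := sub_ne_zero.2 hp
    field_simp
    ring
  rw [norm_smul, Real.norm_of_nonneg (by positivity), ← Real.rpow_add_one hG'.ne',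
    ← Real.rpow_mul hG'.le, smul_smul, ← Real.rpow_add hG', hexp, Real.rpow_zero, one_smul]

theorem exists_rpow_le_inner_gradient (hp : 1 < p) (hV : DifferentiableAt ℝ (pGrad p u) x)
    (h0 : gradient u x = 0) (he : 0 < inner ℝ (fderiv ℝ (pGrad p u) x e) e) :
    ∃ c > 0, ∀ᶠ t in 𝓝[>] (0 : ℝ),
      c * t ^ (1 / (p - 1)) ≤ inner ℝ (gradient u (x + t • e)) e := by
  set b := fderiv ℝ (pGrad p u) x e
  set σ := (2 - p) / (p - 1) with hσ
  have hp' : p - 1 ≠ 0 := by linarith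
  have hb : b ≠ 0 := by
    rintro hb
    simp [hb] at he
  have hderiv : HasDerivAt (fun t : ℝ ↦ pGrad p u (x + t • e)) b 0 := by
    simpa using hasDerivAt_comp_add_smul (x := x) (e := e) (t := 0) (by simpa using hV)
  have hslope : Tendsto (fun t : ℝ ↦ t⁻¹ • pGrad p u (x + t • e)) (𝓝[>] 0) (𝓝 b) := by
    have h := hderiv.tendsto_slope_zero_right
    simpa [pGrad, h0] using h
  have hlim : Tendsto (fun t : ℝ ↦ ‖t⁻¹ • pGrad p u (x + t • e)‖ ^ σ
      * inner ℝ (t⁻¹ • pGrad p u (x + t • e)) e) (𝓝[>] 0) (𝓝 (‖b‖ ^ σ * inner ℝ b e)) :=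
    (hslope.norm.rpow_const (Or.inl (norm_ne_zero_iff.2 hb))).mul (hslope.inner tendsto_const_nhds)
  have hc : 0 < ‖b‖ ^ σ * inner ℝ b e :=
    mul_pos (Real.rpow_pos_of_pos (norm_pos_iff.2 hb) _) he
  refine ⟨_, half_pos hc, ?_⟩
  filter_upwards [hlim.eventually_const_le (half_lt_self hc), self_mem_nhdsWithin]
    with t ht (ht0 : 0 < t)
  have hgrad : gradient u (x + t • e) = ‖pGrad p u (x + t • e)‖ ^ σ • pGrad p u (x + t • e) :=
    (norm_rpow_smul_norm_rpow_smul hp.ne' _).symm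
  have hexp : 1 / (p - 1) = σ + 1 := by rw [hσ]; field_simp; ring
  rw [norm_smul, norm_inv, Real.norm_of_nonneg ht0.le, real_inner_smul_left,
    Real.mul_rpow (by positivity) (norm_nonneg _), Real.inv_rpow ht0.le] at ht
  have _ : 0 < t ^ σ := Real.rpow_pos_of_pos ht0 σ
  rw [hgrad, real_inner_smul_left, hexp, Real.rpow_add_one ht0.ne']
  calc _ ≤ _ := mul_le_mul_of_nonneg_right ht (by positivity)
    _ = _ := by field_simp

theorem eventually_add_rpow_le_of_rpow_le_deriv {h h' : ℝ → ℝ} {c s : ℝ} (hs : -1 < s)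
    (hh : ∀ t, HasDerivAt h (h' t) t) (hle : ∀ᶠ t in 𝓝[>] (0 : ℝ), c * t ^ s ≤ h' t) :
    ∀ᶠ t in 𝓝[>] (0 : ℝ), h 0 + c / (s + 1) * t ^ (s + 1) ≤ h t := by
  have hs' : 0 < s + 1 := by linarith
  obtain ⟨ε, hε, hsub⟩ := mem_nhdsGT_iff_exists_Ioo_subset.1 hle
  filter_upwards [Ioo_mem_nhdsGT hε] with t ht
  have hderiv : ∀ r ∈ interior (Icc 0 t),
      HasDerivAt (fun r ↦ h r - c / (s + 1) * r ^ (s + 1)) (h' r - c * r ^ s) r := by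
    intro r hr
    rw [interior_Icc] at hr
    refine ((hh r).sub ((Real.hasDerivAt_rpow_const (Or.inl hr.1.ne')).const_mul _)).congr_deriv ?_
    rw [add_sub_cancel_right]
    field_simp
  have hcont : ContinuousOn (fun r ↦ h r - c / (s + 1) * r ^ (s + 1)) (Icc 0 t) :=
    (continuous_iff_continuousAt.2 fun r ↦ (hh r).continuousAt).continuousOn.sub
      (continuousOn_const.mul (Real.continuous_rpow_const hs'.le).continuousOn)
  have hmono := monotoneOn_of_deriv_nonneg (convex_Icc 0 t) hcont
    (fun r hr ↦ (hderiv r hr).differentiableAt.differentiableWithinAt) fun r hr ↦ by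
      rw [(hderiv r hr).deriv]
      rw [interior_Icc] at hr
      exact sub_nonneg.2 (hsub ⟨hr.1, hr.2.trans ht.2⟩)
  have hle0 := hmono (left_mem_Icc.2 ht.1.le) (right_mem_Icc.2 ht.1.le) ht.1.le
  simp only [Real.zero_rpow hs'.ne', mul_zero, sub_zero] at hle0
  linarith

theorem exists_add_rpow_le_of_critical (hp : 1 < p) (hu : Differentiable ℝ u)
    (hV : DifferentiableAt ℝ (pGrad p u) x) (h0 : gradient u x = 0) (hpos : 0 < pLaplacian p u x) :
    ∃ e : E n, e ≠ 0 ∧ ∃ c > 0, ∀ᶠ t in 𝓝[>] (0 : ℝ),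
      u x + c * t ^ (p / (p - 1)) ≤ u (x + t • e) := by
  obtain ⟨e, he⟩ := exists_inner_pos_of_trace_pos hpos
  obtain ⟨c, hc, hev⟩ := exists_rpow_le_inner_gradient hp hV h0 he
  have hs : 0 < 1 / (p - 1) := one_div_pos.2 (by linarith)
  have hderiv : ∀ t : ℝ, HasDerivAt (fun t ↦ u (x + t • e))
      (inner ℝ (gradient u (x + t • e)) e) t := fun t ↦ by
    rw [inner_gradient_left]
    exact hasDerivAt_comp_add_smul (hu _)
  have hexp : p / (p - 1) = 1 / (p - 1) + 1 := by
    have : p - 1 ≠ 0 := by linarith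
    field_simp
    ring
  have hgrow := eventually_add_rpow_le_of_rpow_le_deriv (by linarith) hderiv hev
  refine ⟨e, fun h ↦ by simp [h] at he, c / (1 / (p - 1) + 1), by positivity, ?_⟩
  simpa [hexp] using hgrow

theorem not_isLocalMax_sub_of_critical (hp : 1 < p) (hu : Differentiable ℝ u)
    (hV : DifferentiableAt ℝ (pGrad p u) x) (h0 : gradient u x = 0) (hpos : 0 < pLaplacian p u x)
    (hv : (fun z ↦ v z - v x) =o[𝓝 x] fun z ↦ ‖z - x‖ ^ (p / (p - 1))) :
    ¬ IsLocalMax (fun z ↦ u z - v z) x := by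
  intro hmax
  obtain ⟨e, he, c, hc, hgrow⟩ := exists_add_rpow_le_of_critical hp hu hV h0 hpos
  have he' : 0 < ‖e‖ ^ (p / (p - 1)) := Real.rpow_pos_of_pos (norm_pos_iff.2 he) _
  have htend := (tendsto_add_smul x e).mono_left (nhdsWithin_le_nhds (s := Ioi 0))
  have hsmall := htend.eventually (hv.def (div_pos (half_pos hc) he'))
  obtain ⟨t, ⟨ht_grow, ht_small, ht_max⟩, ht⟩ :=
    ((hgrow.and (hsmall.and (htend.eventually hmax))).and self_mem_nhdsWithin).exists
  have ht0 : (0 : ℝ) < t := ht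
  have hpow : ‖‖x + t • e - x‖ ^ (p / (p - 1))‖ = ‖e‖ ^ (p / (p - 1)) * t ^ (p / (p - 1)) := by
    rw [Real.norm_of_nonneg (by positivity), add_sub_cancel_left, norm_smul,
      Real.norm_of_nonneg ht0.le, Real.mul_rpow ht0.le (norm_nonneg _), mul_comm]
  rw [hpow, ← mul_assoc, div_mul_cancel₀ _ he'.ne'] at ht_small
  have hgap : 0 < c * t ^ (p / (p - 1)) := by positivity
  linarith [le_of_abs_le ht_small]

end CriticalGrowth

section MaximumPrinciple

variable {n : ℕ} {p : ℝ} {u : E n → ℝ}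

/-- `u` is strictly `p`-subharmonic away from the origin, in the classical sense, and `C¹` across
the origin. -/
structure IsPSubharmonicOffZero (p : ℝ) (u : E n → ℝ) : Prop where
  contDiff_one : ContDiff ℝ 1 u
  contDiffOn_two : ContDiffOn ℝ 2 u {0}ᶜ
  differentiableAt_pGrad : ∀ x : E n, x ≠ 0 → DifferentiableAt ℝ (pGrad p u) x
  pLaplacian_pos : ∀ x : E n, x ≠ 0 → 0 < pLaplacian p u x

namespace IsPSubharmonicOffZero

theorem contDiffAt_two (h : IsPSubharmonicOffZero p u) {x : E n} (hx : x ≠ 0) :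
    ContDiffAt ℝ 2 u x :=
  h.contDiffOn_two.contDiffAt (isOpen_compl_singleton.mem_nhds hx)

theorem differentiable (h : IsPSubharmonicOffZero p u) : Differentiable ℝ u :=
  h.contDiff_one.differentiable one_ne_zero

theorem not_isLocalMax_sub_of_critical (h : IsPSubharmonicOffZero p u) (hp : 1 < p)
    {v : E n → ℝ} {x : E n} (hx : x ≠ 0) (h0 : gradient u x = 0)
    (hv : (fun z ↦ v z - v x) =o[𝓝 x] fun z ↦ ‖z - x‖ ^ (p / (p - 1))) :
    ¬ IsLocalMax (fun z ↦ u z - v z) x :=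
  HessianSub.not_isLocalMax_sub_of_critical hp h.differentiable (h.differentiableAt_pGrad x hx) h0
    (h.pLaplacian_pos x hx) hv

theorem not_isLocalMax_of_ne_zero (h : IsPSubharmonicOffZero p u) (hp : 1 < p) {x : E n}
    (hx : x ≠ 0) : ¬ IsLocalMax u x := fun hmax ↦
  h.not_isLocalMax_sub_of_critical hp hx (v := fun _ ↦ 0)
    (by rw [gradient, hmax.fderiv_eq_zero, map_zero])
    (by simpa only [sub_self] using Asymptotics.isLittleO_zero _ _) (by simpa using hmax)

theorem not_isLocalMax_add_mul_norm (h : IsPSubharmonicOffZero p u) (hp : 1 ≤ p) (hn : 0 < n)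
    {x : E n} (hx : x ≠ 0) {a : ℝ} (ha : 0 < a) : ¬ IsLocalMax (fun z ↦ u z + a * ‖z‖) x := by
  intro hmax
  have hφ : ∀ r : ℝ, HasDerivAt (fun r ↦ -a * r) (-a) r := fun r ↦ by
    simpa using (hasDerivAt_id r).const_mul (-a)
  have hle := pLaplacian_le_of_isLocalMax_sub_radial (φ := fun r ↦ -a * r) hp hx
    (h.contDiffAt_two hx) (Eventually.of_forall hφ) (hasDerivAt_const _ (-a)) (neg_ne_zero.2 ha.ne')
    (by simpa using hmax)
  have hneg : ((n : ℝ) - 1) * (-a / ‖x - 0‖) ≤ 0 :=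
    mul_nonpos_of_nonneg_of_nonpos (sub_nonneg.2 (mod_cast hn))
      (div_nonpos_of_nonpos_of_nonneg (neg_nonpos.2 ha.le) (norm_nonneg _))
  rw [mul_zero, zero_add] at hle
  exact (h.pLaplacian_pos x hx).not_ge <| hle.trans <|
    mul_nonpos_of_nonneg_of_nonpos (by positivity) hneg

theorem exists_ball_forall_lt_of_isLocalMax_zero (h : IsPSubharmonicOffZero p u) (hp : 1 < p)
    (hmax : IsLocalMax u 0) : ∃ ρ > 0, ∀ x : E n, ‖x‖ < ρ → x ≠ 0 → u x < u 0 := by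
  obtain ⟨ρ, hρ, hball⟩ := Metric.eventually_nhds_iff_ball.1 hmax
  refine ⟨ρ, hρ, fun x hxρ hx ↦ ?_⟩
  rw [← mem_ball_zero_iff] at hxρ
  refine (hball x hxρ).lt_of_ne fun heq ↦ h.not_isLocalMax_of_ne_zero hp hx ?_
  filter_upwards [Metric.isOpen_ball.mem_nhds hxρ] with y hy using (hball y hy).trans_eq heq.symm

theorem exists_le_sub_mul_norm_of_isLocalMax_zero (h : IsPSubharmonicOffZero p u) (hp : 1 < p)
    (hn : 0 < n) (hmax : IsLocalMax u 0) : ∃ a > 0, ∀ᶠ x in 𝓝 0, u x ≤ u 0 - a * ‖x‖ := by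
  have : NeZero n := ⟨hn.ne'⟩
  have hcont : Continuous u := h.differentiable.continuous
  obtain ⟨ρ, hρ, hlt⟩ := h.exists_ball_forall_lt_of_isLocalMax_zero hp hmax
  obtain ⟨r, hr, hrρ⟩ := exists_between hρ
  obtain ⟨z, hz, hzmax⟩ := (isCompact_sphere (0 : E n) r).exists_isMaxOn
    (NormedSpace.sphere_nonempty.2 hr.le) hcont.continuousOn
  rw [mem_sphere_zero_iff_norm] at hz
  have hgap : 0 < u 0 - u z :=
    sub_pos.2 (hlt z (hz.trans_lt hrρ) (norm_pos_iff.1 (hz ▸ hr)))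
  set a := (u 0 - u z) / r with ha_def
  have ha : 0 < a := div_pos hgap hr
  refine ⟨a, ha, ?_⟩
  obtain ⟨y, hy, hymax⟩ := (isCompact_closedBall (0 : E n) r).exists_isMaxOn
    ⟨0, Metric.mem_closedBall_self hr.le⟩ (f := fun x ↦ u x + a * ‖x‖) (by fun_prop)
  have hyle : u y + a * ‖y‖ ≤ u 0 := by
    obtain rfl | hy0 := eq_or_ne y 0
    · simp
    rw [mem_closedBall_zero_iff] at hy
    obtain hy_eq | hy_lt := hy.eq_or_lt
    · have hyz : u y ≤ u z := hzmax (mem_sphere_zero_iff_norm.2 hy_eq)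
      rw [hy_eq, ha_def, div_mul_cancel₀ _ hr.ne']
      linarith
    · exact absurd
        (hymax.isLocalMax (Metric.closedBall_mem_nhds_of_mem (mem_ball_zero_iff.2 hy_lt)))
        (h.not_isLocalMax_add_mul_norm hp.le hn hy0 ha)
  filter_upwards [Metric.closedBall_mem_nhds (0 : E n) hr] with x hx
  have hxy : u x + a * ‖x‖ ≤ u y + a * ‖y‖ := hymax hx
  linarith

-- A local maximum at `0` would lie below a downward cone, which is not differentiable there.
theorem not_isLocalMax (h : IsPSubharmonicOffZero p u) (hp : 1 < p) (hn : 0 < n) (x : E n) :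
    ¬ IsLocalMax u x := by
  obtain hx | rfl := ne_or_eq x 0
  · exact h.not_isLocalMax_of_ne_zero hp hx
  intro hmax
  have : NeZero n := ⟨hn.ne'⟩
  obtain ⟨a, ha, hcone⟩ := h.exists_le_sub_mul_norm_of_isLocalMax_zero hp hn hmax
  have hd : HasFDerivAt u (0 : E n →L[ℝ] ℝ) 0 :=
    hmax.fderiv_eq_zero ▸ (h.differentiable 0).hasFDerivAt
  have hsmall := hd.isLittleO.def (half_pos ha)
  obtain ⟨x, ⟨hx_cone, hx_small⟩, hx⟩ := (((hcone.and hsmall).filter_mono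
    nhdsWithin_le_nhds).and (self_mem_nhdsWithin (s := {(0 : E n)}ᶜ))).exists
  have hx_norm : 0 < a * ‖x‖ := mul_pos ha (norm_pos_iff.2 hx)
  simp only [zero_apply, sub_zero, Real.norm_eq_abs] at hx_small
  linarith [neg_le_of_abs_le hx_small]

end IsPSubharmonicOffZero

end MaximumPrinciple

section Barrier

variable {n : ℕ} {p α β d C l R r s μ γ : ℝ} {u : E n → ℝ} {y : E n}

/-- The radial profile `l (1 - (r/R)^μ)^{-γ}`, which equals `l` at `r = 0` and blows up as
`r → R⁻`. Composed with `‖· - y‖` it is a supersolution on the ball of radius `R` about `y` for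
suitable `μ`, `γ` and `l`. -/
def barrier (l R μ γ r : ℝ) : ℝ := l * (1 - (r / R) ^ μ) ^ (-γ)

/-- The first derivative of `barrier` in `r`. -/
def barrierDeriv (l R μ γ r : ℝ) : ℝ :=
  l * γ * μ * ((r / R) ^ μ / r) * (1 - (r / R) ^ μ) ^ (-γ - 1)

/-- The second derivative of `barrier` in `r`. -/
def barrierDeriv₂ (l R μ γ r : ℝ) : ℝ :=
  barrierDeriv l R μ γ r / r * (μ - 1 + (γ + 1) * μ * (r / R) ^ μ / (1 - (r / R) ^ μ))

theorem barrier_zero (hμ : μ ≠ 0) : barrier l R μ γ 0 = l := by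
  simp [barrier, Real.zero_rpow hμ]

theorem one_sub_div_rpow_pos (hμ : 0 < μ) (hr : r ∈ Ico 0 R) : 0 < 1 - (r / R) ^ μ :=
  sub_pos.2 <| Real.rpow_lt_one (div_nonneg hr.1 (hr.1.trans hr.2.le))
    ((div_lt_one (hr.1.trans_lt hr.2)).2 hr.2) hμ

theorem barrierDeriv_pos (hl : 0 < l) (hμ : 0 < μ) (hγ : 0 < γ) (hr : r ∈ Ioo 0 R) :
    0 < barrierDeriv l R μ γ r := by
  have ht := one_sub_div_rpow_pos hμ (Ioo_subset_Ico_self hr)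
  have hr0 := hr.1
  have hR : 0 < R := hr0.trans hr.2
  unfold barrierDeriv
  positivity

theorem hasDerivAt_div_rpow (hr : r ∈ Ioo 0 R) :
    HasDerivAt (fun r ↦ (r / R) ^ μ) (μ * ((r / R) ^ μ / r)) r := by
  have hr0 := hr.1
  have hR : 0 < R := hr0.trans hr.2
  refine (((hasDerivAt_id r).div_const R).rpow_const (Or.inl (div_pos hr0 hR).ne')).congr_deriv ?_
  simp only [id, Real.rpow_sub_one (div_pos hr0 hR).ne']
  field_simp

theorem hasDerivAt_one_sub_div_rpow_rpow (hμ : 0 < μ) (hr : r ∈ Ioo 0 R) :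
    HasDerivAt (fun r ↦ (1 - (r / R) ^ μ) ^ s)
      (-(s * μ * ((r / R) ^ μ / r) * (1 - (r / R) ^ μ) ^ (s - 1))) r := by
  have ht := one_sub_div_rpow_pos hμ (Ioo_subset_Ico_self hr)
  refine (((hasDerivAt_div_rpow hr).const_sub 1).rpow_const (Or.inl ht.ne')).congr_deriv ?_
  ring

theorem hasDerivAt_barrier (hμ : 0 < μ) (hr : r ∈ Ioo 0 R) :
    HasDerivAt (barrier l R μ γ) (barrierDeriv l R μ γ r) r := by
  refine ((hasDerivAt_one_sub_div_rpow_rpow hμ hr).const_mul l).congr_deriv ?_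
  rw [barrierDeriv]
  ring

theorem hasDerivAt_barrierDeriv (hμ : 0 < μ) (hr : r ∈ Ioo 0 R) :
    HasDerivAt (barrierDeriv l R μ γ) (barrierDeriv₂ l R μ γ r) r := by
  have ht := one_sub_div_rpow_pos hμ (Ioo_subset_Ico_self hr)
  refine ((((hasDerivAt_div_rpow hr).fun_div (hasDerivAt_id r) hr.1.ne').const_mul
    (l * γ * μ)).fun_mul (hasDerivAt_one_sub_div_rpow_rpow hμ hr)).congr_deriv ?_
  have hr0 := hr.1.ne'
  simp only [id, barrierDeriv₂, barrierDeriv, Real.rpow_sub_one ht.ne' (-γ - 1)]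
  field_simp
  ring

theorem barrierDeriv₂_le (hl : 0 < l) (hμ : 0 < μ) (hγ : 0 < γ) (hr : r ∈ Ioo 0 R) :
    barrierDeriv₂ l R μ γ r ≤
      (γ + 1) * μ * (barrierDeriv l R μ γ r / (r * (1 - (r / R) ^ μ))) := by
  have ht := one_sub_div_rpow_pos hμ (Ioo_subset_Ico_self hr)
  have hφ' := barrierDeriv_pos hl hμ hγ hr
  have hle : μ - 1 + (γ + 1) * μ * (r / R) ^ μ / (1 - (r / R) ^ μ)
      ≤ (γ + 1) * μ / (1 - (r / R) ^ μ) := by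
    rw [← le_sub_iff_add_le, ← sub_div, ← mul_one_sub, mul_div_cancel_right₀ _ ht.ne']
    nlinarith
  calc barrierDeriv₂ l R μ γ r
      ≤ barrierDeriv l R μ γ r / r * ((γ + 1) * μ / (1 - (r / R) ^ μ)) :=
        mul_le_mul_of_nonneg_left hle (div_pos hφ' hr.1).le
    _ = _ := by rw [div_mul_div_comm, ← mul_div_assoc, mul_comm]

theorem barrierDeriv_rpow_div_le (hl : 0 < l) (hμ : 0 < μ) (hγ : 0 < γ)
    (hμs : s + 1 ≤ μ * s) (hγs : s + 1 ≤ γ * (d - s)) (hr : r ∈ Ioo 0 R) :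
    barrierDeriv l R μ γ r ^ s / (r * (1 - (r / R) ^ μ)) ≤
      (γ * μ) ^ s * l ^ (-(d - s)) * R ^ (-(s + 1)) * barrier l R μ γ r ^ d := by
  have ht := one_sub_div_rpow_pos hμ (Ioo_subset_Ico_self hr)
  have hr0 : 0 < r := hr.1
  have hR : 0 < R := hr0.trans hr.2
  have hrR : 0 < r / R := div_pos hr0 hR
  set τ := 1 - (r / R) ^ μ with hτ
  have hτ1 : τ ≤ 1 := sub_le_self _ (by positivity)
  have hinner : ((r / R) ^ μ / r) ^ s / r ≤ R ^ (-(s + 1)) := by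
    calc ((r / R) ^ μ / r) ^ s / r = (r / R) ^ (μ * s) / r ^ (s + 1) := by
          rw [Real.div_rpow (by positivity) hr0.le, ← Real.rpow_mul hrR.le,
            Real.rpow_add_one hr0.ne', div_div]
      _ ≤ (r / R) ^ (s + 1) / r ^ (s + 1) := by
          gcongr ?_ / _
          exact Real.rpow_le_rpow_of_exponent_ge hrR ((div_le_one hR).2 hr.2.le) hμs
      _ = R ^ (-(s + 1)) := by
          rw [Real.div_rpow hr0.le hR.le, Real.rpow_neg hR.le]
          field_simp
  have houter : (τ ^ (-γ - 1)) ^ s / τ ≤ τ ^ (-γ * d) := by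
    rw [← Real.rpow_mul ht.le, ← Real.rpow_sub_one ht.ne']
    exact Real.rpow_le_rpow_of_exponent_ge ht hτ1 (by linarith)
  calc barrierDeriv l R μ γ r ^ s / (r * τ)
      = (γ * μ) ^ s * l ^ s * (((r / R) ^ μ / r) ^ s / r) * ((τ ^ (-γ - 1)) ^ s / τ) := by
        rw [barrierDeriv, ← hτ, Real.mul_rpow (by positivity) (by positivity),
          Real.mul_rpow (by positivity) (by positivity), mul_assoc l,
          Real.mul_rpow hl.le (by positivity)]
        field_simp
    _ ≤ (γ * μ) ^ s * l ^ s * R ^ (-(s + 1)) * τ ^ (-γ * d) := by gcongr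
    _ = _ := by
        rw [barrier, Real.mul_rpow hl.le (by positivity), ← Real.rpow_mul ht.le,
          neg_sub, Real.rpow_sub hl]
        field_simp

theorem radial_pLaplacian_barrier_le (n : ℕ) (hp : 1 ≤ p) (hl : 0 < l)
    (hμ : 0 < μ) (hγ : 0 < γ) (hμβ : p - β ≤ μ * (p - β - 1))
    (hγβ : p - β ≤ γ * (d - (p - β - 1))) (hr : r ∈ Ioo 0 R) :
    |barrierDeriv l R μ γ r| ^ (p - 2) *
        ((p - 1) * barrierDeriv₂ l R μ γ r + (n - 1) * (barrierDeriv l R μ γ r / r)) ≤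
      ((p - 1) * ((γ + 1) * μ) + n) * (γ * μ) ^ (p - β - 1) *
        (l ^ (-(d - (p - β - 1))) * R ^ (-(p - β))) *
        (barrierDeriv l R μ γ r ^ β * barrier l R μ γ r ^ d) := by
  have ht := one_sub_div_rpow_pos hμ (Ioo_subset_Ico_self hr)
  have hr0 : 0 < r := hr.1
  have hφ' := barrierDeriv_pos hl hμ hγ hr
  have hpow := barrierDeriv_rpow_div_le (s := p - β - 1) (d := d) hl hμ hγ (by linarith)
    (by linarith) hr
  rw [sub_add_cancel] at hpow
  have hφ'' := barrierDeriv₂_le hl hμ hγ hr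
  set φ' := barrierDeriv l R μ γ r
  set τ := 1 - (r / R) ^ μ
  have hτ1 : τ ≤ 1 := sub_le_self _ (Real.rpow_nonneg (div_nonneg hr0.le (hr0.trans hr.2).le) _)
  have htang : (n - 1) * (φ' / r) ≤ n * (φ' / (r * τ)) := by
    calc ((n : ℝ) - 1) * (φ' / r) ≤ n * (φ' / r) := by gcongr; linarith
      _ ≤ n * (φ' / (r * τ)) := by gcongr; exact mul_le_of_le_one_right hr0.le hτ1
  have hexp : φ' ^ (p - 2) * (φ' / (r * τ)) = φ' ^ β * (φ' ^ (p - β - 1) / (r * τ)) := by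
    rw [← mul_div_assoc, ← mul_div_assoc, ← Real.rpow_add_one hφ'.ne', ← Real.rpow_add hφ']
    ring_nf
  calc |φ'| ^ (p - 2) * ((p - 1) * barrierDeriv₂ l R μ γ r + (n - 1) * (φ' / r))
      ≤ φ' ^ (p - 2) * ((p - 1) * ((γ + 1) * μ * (φ' / (r * τ))) + n * (φ' / (r * τ))) := by
        rw [abs_of_pos hφ']
        gcongr
    _ = ((p - 1) * ((γ + 1) * μ) + n) * (φ' ^ β * (φ' ^ (p - β - 1) / (r * τ))) := by
        rw [← hexp]
        ring
    _ ≤ ((p - 1) * ((γ + 1) * μ) + n) * (φ' ^ β * ((γ * μ) ^ (p - β - 1) *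
          l ^ (-(d - (p - β - 1))) * R ^ (-(p - β)) * barrier l R μ γ r ^ d)) := by
        gcongr
    _ = _ := by ring

theorem tendsto_barrier_atTop (hl : 0 < l) (hR : 0 < R) (hμ : 0 < μ) (hγ : 0 < γ) :
    Tendsto (barrier l R μ γ) (𝓝[<] R) atTop := by
  have hcont : ContinuousAt (fun r ↦ 1 - (r / R) ^ μ) R :=
    continuousAt_const.sub ((continuousAt_id.div_const R).rpow_const (Or.inr hμ.le))
  have hlim : Tendsto (fun r ↦ 1 - (r / R) ^ μ) (𝓝[<] R) (𝓝[>] 0) := by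
    refine tendsto_nhdsWithin_iff.2 ⟨?_, ?_⟩
    · simpa [hR.ne'] using hcont.tendsto.mono_left nhdsWithin_le_nhds
    · filter_upwards [Ioo_mem_nhdsLT hR] with r hr
        using one_sub_div_rpow_pos hμ (Ioo_subset_Ico_self hr)
  exact ((tendsto_rpow_neg_nhdsGT_zero (neg_neg_of_pos hγ)).comp hlim).const_mul_atTop hl

theorem continuousOn_barrier (hμ : 0 < μ) : ContinuousOn (barrier l R μ γ) (Ico 0 R) := by
  refine continuousOn_const.mul (ContinuousOn.rpow_const ?_ fun r hr ↦
    Or.inl (one_sub_div_rpow_pos hμ hr).ne')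
  exact continuousOn_const.sub ((continuousOn_id.div_const R).rpow_const fun _ _ ↦ Or.inr hμ.le)

theorem barrier_sub_isLittleO (hR : 0 ≤ R) (hs : 0 ≤ s) (hsμ : s < μ) :
    (fun r ↦ barrier l R μ γ r - l) =o[𝓝[≥] 0] fun r ↦ r ^ s := by
  have hμ : 0 < μ := hs.trans_lt hsμ
  have hpow : Tendsto (fun r : ℝ ↦ (r / R) ^ μ) (𝓝[≥] 0) (𝓝 0) := by
    have h : ContinuousAt (fun r : ℝ ↦ (r / R) ^ μ) 0 :=
      (continuousAt_id.div_const R).rpow_const (Or.inr hμ.le)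
    simpa [hμ.ne'] using h.tendsto.mono_left nhdsWithin_le_nhds
  have hprofile : HasDerivAt (fun t : ℝ ↦ l * (1 - t) ^ (-γ)) (l * γ) 0 := by
    refine ((((hasDerivAt_id (0 : ℝ)).const_sub 1).rpow_const (p := -γ)
      (Or.inl (by simp))).const_mul l).congr_deriv ?_
    simp
  have hO : (fun r ↦ barrier l R μ γ r - l) =O[𝓝[≥] 0] fun r ↦ (r / R) ^ μ := by
    simpa [barrier, Function.comp_def] using hprofile.isBigO_sub.comp_tendsto hpow
  have ho : (fun r : ℝ ↦ r ^ (μ - s) / R ^ μ) =o[𝓝[≥] 0] fun _ ↦ (1 : ℝ) := by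
    have h : ContinuousAt (fun r : ℝ ↦ r ^ (μ - s) / R ^ μ) 0 :=
      (Real.continuousAt_rpow_const _ _ (Or.inr (sub_pos.2 hsμ).le)).div_const _
    refine (Asymptotics.isLittleO_one_iff ℝ).2 ?_
    simpa [(sub_pos.2 hsμ).ne'] using h.tendsto.mono_left nhdsWithin_le_nhds
  refine hO.trans_isLittleO ((ho.mul_isBigO (Asymptotics.isBigO_refl (fun r ↦ r ^ s) _)).congr' ?_
    (by simp))
  filter_upwards [self_mem_nhdsWithin] with r (hr : 0 ≤ r)
  rw [Real.div_rpow hr hR, div_mul_eq_mul_div,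
    ← Real.rpow_add_of_nonneg hr (sub_pos.2 hsμ).le hs, sub_add_cancel]

theorem barrier_norm_sub_isLittleO (hR : 0 ≤ R) (hs : 0 ≤ s) (hsμ : s < μ) (y : E n) :
    (fun z ↦ barrier l R μ γ ‖z - y‖ - l) =o[𝓝 y] fun z ↦ ‖z - y‖ ^ s := by
  have hnorm : Tendsto (fun z ↦ ‖z - y‖) (𝓝 y) (𝓝[≥] 0) :=
    tendsto_nhdsWithin_iff.2 ⟨tendsto_norm_sub_self y, Eventually.of_forall fun _ ↦ norm_nonneg _⟩
  exact (barrier_sub_isLittleO hR hs hsμ).comp_tendsto hnorm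

theorem exists_isLocalMax_sub_radial {φ : ℝ → ℝ} (hu : Continuous u) (hR : 0 < R)
    (hφ : ContinuousOn φ (Ico 0 R)) (htop : Tendsto φ (𝓝[<] R) atTop) (hy : φ 0 < u y) :
    ∃ x ∈ Metric.ball y R, IsLocalMax (fun z ↦ u z - φ ‖z - y‖) x ∧ φ ‖x - y‖ < u x := by
  obtain ⟨M, hM⟩ := (isCompact_closedBall y R).bddAbove_image hu.continuousOn
  obtain ⟨ρ, hρM, hρ⟩ := ((htop.eventually_ge_atTop M).and (Ioo_mem_nhdsLT hR)).exists
  obtain ⟨x, hx, hmax⟩ := (isCompact_closedBall y ρ).exists_isMaxOn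
    ⟨y, Metric.mem_closedBall_self hρ.1.le⟩ (f := fun z ↦ u z - φ ‖z - y‖) <|
    hu.continuousOn.sub <| hφ.comp (by fun_prop) fun z hz ↦
      ⟨norm_nonneg _, (mem_closedBall_iff_norm.1 hz).trans_lt hρ.2⟩
  have hlt : φ ‖x - y‖ < u x := by
    have h : u y - φ ‖y - y‖ ≤ u x - φ ‖x - y‖ := hmax (Metric.mem_closedBall_self hρ.1.le)
    rw [sub_self, norm_zero] at h
    linarith
  have hxρ : ‖x - y‖ ≠ ρ := fun h ↦ hlt.not_ge <| h ▸ (hM <| mem_image_of_mem u <|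
    Metric.closedBall_subset_closedBall hρ.2.le hx).trans hρM
  have hx' : x ∈ Metric.ball y ρ :=
    mem_ball_iff_norm.2 ((mem_closedBall_iff_norm.1 hx).lt_of_ne hxρ)
  exact ⟨x, Metric.ball_subset_ball hρ.2.le hx',
    hmax.isLocalMax (Metric.closedBall_mem_nhds_of_mem hx'), hlt⟩

theorem IsPSubharmonicOffZero.not_isLocalMax_sub_barrier_center (h : IsPSubharmonicOffZero p u)
    (hp : 1 < p) (hy : y ≠ 0) (hR : 0 ≤ R) (hμ : p / (p - 1) < μ) :
    ¬ IsLocalMax (fun z ↦ u z - barrier l R μ γ ‖z - y‖) y := by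
  intro hmax
  have hs : 1 < p / (p - 1) := (one_lt_div (by linarith)).2 (by linarith)
  have hzero : barrier l R μ γ ‖y - y‖ = l := by
    rw [sub_self, norm_zero, barrier_zero (by linarith)]
  have hderiv : HasFDerivAt (fun z ↦ barrier l R μ γ ‖z - y‖) (0 : E n →L[ℝ] ℝ) y := by
    refine .of_isLittleO ?_
    simpa only [hzero, zero_apply, sub_zero, Real.rpow_one, Asymptotics.isLittleO_norm_right]
      using barrier_norm_sub_isLittleO hR zero_le_one (hs.trans hμ) y
  have hgrad : gradient u y = 0 := by
    have h0 := hmax.hasFDerivAt_eq_zero ((h.differentiable y).hasFDerivAt.sub hderiv)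
    rw [sub_zero] at h0
    rw [gradient, h0, map_zero]
  refine h.not_isLocalMax_sub_of_critical hp hy hgrad ?_ hmax
  simpa only [hzero] using barrier_norm_sub_isLittleO hR (by linarith) hμ y

theorem not_isLocalMax_sub_radial_of_supersolution {x : E n} {φ φ' : ℝ → ℝ} {φ'' : ℝ} (hp : 1 ≤ p)
    (hC : 0 ≤ C) (hd : 0 < d) (hx : x ≠ 0) (hxy : x ≠ y) (hu : ContDiffAt ℝ 2 u x)
    (hsub : gradient u x ≠ 0 → 0 < u x →
      ‖x‖ ^ α * ‖gradient u x‖ ^ β * u x ^ d ≤ C * pLaplacian p u x)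
    (hφ : ∀ᶠ r in 𝓝 ‖x - y‖, HasDerivAt φ (φ' r) r) (hφ' : HasDerivAt φ' φ'' ‖x - y‖)
    (hpos : 0 < φ ‖x - y‖) (hpos' : 0 < φ' ‖x - y‖) (hlt : φ ‖x - y‖ < u x)
    (hsuper : C * (|φ' ‖x - y‖| ^ (p - 2) *
        ((p - 1) * φ'' + (n - 1) * (φ' ‖x - y‖ / ‖x - y‖))) ≤
      ‖x‖ ^ α * φ' ‖x - y‖ ^ β * φ ‖x - y‖ ^ d) :
    ¬ IsLocalMax (fun z ↦ u z - φ ‖z - y‖) x := by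
  intro hmax
  have _ : 0 < ‖x‖ := norm_pos_iff.2 hx
  have hnorm : ‖gradient u x‖ = φ' ‖x - y‖ := by
    rw [gradient_eq_of_isLocalMax_sub_radial hxy (hu.differentiableAt two_ne_zero) hφ.self_of_nhds
      hmax, norm_smul, norm_div, norm_norm, div_mul_cancel₀ _ (norm_ne_zero_iff.2
      (sub_ne_zero.2 hxy)), Real.norm_of_nonneg hpos'.le]
  have hle := hsub (norm_pos_iff.1 (hnorm ▸ hpos')) (hpos.trans hlt)
  rw [hnorm] at hle
  refine lt_irrefl (‖x‖ ^ α * φ' ‖x - y‖ ^ β * u x ^ d) ?_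
  calc _ ≤ C * pLaplacian p u x := hle
    _ ≤ _ := mul_le_mul_of_nonneg_left
      (pLaplacian_le_of_isLocalMax_sub_radial hp hxy hu hφ hφ' hpos'.ne' hmax) hC
    _ ≤ _ := hsuper
    _ < _ := by gcongr

theorem IsPSubharmonicOffZero.le_of_forall_ball (h : IsPSubharmonicOffZero p u) (hp : 1 < p)
    (hC : 0 ≤ C) (hd : 0 < d)
    (hsub : ∀ x : E n, x ≠ 0 → gradient u x ≠ 0 → 0 < u x →
      ‖x‖ ^ α * ‖gradient u x‖ ^ β * u x ^ d ≤ C * pLaplacian p u x)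
    (hμ : p / (p - 1) < μ) (hγ : 0 < γ) (hμβ : p - β ≤ μ * (p - β - 1))
    (hγβ : p - β ≤ γ * (d - (p - β - 1))) (hl : 0 < l) (hR : 0 < R) (hRy : R ≤ ‖y‖)
    (hball : ∀ x ∈ Metric.ball y R, C * (((p - 1) * ((γ + 1) * μ) + n) * (γ * μ) ^ (p - β - 1) *
      (l ^ (-(d - (p - β - 1))) * R ^ (-(p - β)))) ≤ ‖x‖ ^ α) :
    u y ≤ l := by
  have hμ0 : 0 < μ := (div_pos (by linarith) (by linarith)).trans hμ
  by_contra! hlt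
  obtain ⟨x, hx, hmax, hux⟩ := exists_isLocalMax_sub_radial (φ := barrier l R μ γ)
    h.differentiable.continuous hR (continuousOn_barrier hμ0) (tendsto_barrier_atTop hl hR hμ0 hγ)
    (by rwa [barrier_zero hμ0.ne'])
  have hx0 : x ≠ 0 := by
    rintro rfl
    rw [mem_ball_iff_norm, zero_sub, norm_neg] at hx
    exact hx.not_ge hRy
  have hxy : x ≠ y := by
    rintro rfl
    exact h.not_isLocalMax_sub_barrier_center hp hx0 hR.le hμ hmax
  have hr : ‖x - y‖ ∈ Ioo 0 R := ⟨norm_pos_iff.2 (sub_ne_zero.2 hxy), mem_ball_iff_norm.1 hx⟩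
  have hpos' := barrierDeriv_pos hl hμ0 hγ hr
  have hpos : 0 < barrier l R μ γ ‖x - y‖ :=
    mul_pos hl (Real.rpow_pos_of_pos (one_sub_div_rpow_pos hμ0 (Ioo_subset_Ico_self hr)) _)
  refine not_isLocalMax_sub_radial_of_supersolution hp.le hC hd hx0 hxy (h.contDiffAt_two hx0)
    (hsub x hx0) (Eventually.mono (Ioo_mem_nhds hr.1 hr.2) fun _ ↦ hasDerivAt_barrier hμ0)
    (hasDerivAt_barrierDeriv hμ0 hr) hpos hpos' hux ?_ hmax
  calc _ ≤ _ := mul_le_mul_of_nonneg_left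
        (radial_pLaplacian_barrier_le n hp.le hl hμ0 hγ hμβ hγβ hr) hC
    _ ≤ ‖x‖ ^ α * (barrierDeriv l R μ γ ‖x - y‖ ^ β * barrier l R μ γ ‖x - y‖ ^ d) := by
        rw [← mul_assoc C]
        exact mul_le_mul_of_nonneg_right (hball x hx) (by positivity)
    _ = _ := (mul_assoc _ _ _).symm

end Barrier

section Liouville

variable {n : ℕ} {p α β d C : ℝ} {u : E n → ℝ}

theorem exists_mul_rpow_le_of_mem_ball (n : ℕ) (α : ℝ) :
    ∃ c > 0, ∀ y : E n, ∀ x ∈ Metric.ball y (‖y‖ / 2), c * ‖y‖ ^ α ≤ ‖x‖ ^ α := by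
  refine ⟨min ((1 / 2) ^ α) ((3 / 2) ^ α), by positivity, fun y x hx ↦ ?_⟩
  rw [mem_ball_iff_norm] at hx
  have hlower : 1 / 2 * ‖y‖ < ‖x‖ := by linarith [norm_sub_norm_le y x, norm_sub_rev x y]
  have hupper : ‖x‖ < 3 / 2 * ‖y‖ := by linarith [norm_sub_norm_le x y]
  have hy : 0 < ‖y‖ := by linarith [norm_nonneg (x - y)]
  obtain hα | hα := le_total 0 α
  · calc _ ≤ (1 / 2) ^ α * ‖y‖ ^ α := by gcongr; exact min_le_left _ _
      _ = (1 / 2 * ‖y‖) ^ α := (Real.mul_rpow (by norm_num) hy.le).symm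
      _ ≤ ‖x‖ ^ α := by gcongr
  · calc _ ≤ (3 / 2) ^ α * ‖y‖ ^ α := by gcongr; exact min_le_right _ _
      _ = (3 / 2 * ‖y‖) ^ α := (Real.mul_rpow (by norm_num) hy.le).symm
      _ ≤ ‖x‖ ^ α := Real.rpow_le_rpow_of_nonpos (by linarith) hupper.le hα

theorem mul_rpow_neg_mul_half_rpow_neg {A c q ρ : ℝ} (hA : 0 < A) (hc : 0 < c) (hq : q ≠ 0)
    (hρ : 0 < ρ) (s α : ℝ) :
    A * (((A * 2 ^ s / c) ^ (1 / q) * ρ ^ (-((s + α) / q))) ^ (-q) * (ρ / 2) ^ (-s)) =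
      c * ρ ^ α := by
  have hexp : 1 / q * -q = -1 := by field_simp
  have hexp' : -((s + α) / q) * -q = s + α := by field_simp
  rw [Real.mul_rpow (by positivity) (by positivity), ← Real.rpow_mul (by positivity),
    ← Real.rpow_mul hρ.le, hexp, hexp', Real.rpow_neg_one, Real.rpow_add hρ,
    Real.rpow_neg (by positivity), Real.div_rpow hρ.le zero_le_two]
  field_simp

namespace IsPSubharmonicOffZero

theorem exists_forall_ball_le (h : IsPSubharmonicOffZero p u) (hp : 1 < p) (hC : 0 < C)
    (hβ : β < p - 1) (hd : p - β - 1 < d)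
    (hsub : ∀ x : E n, x ≠ 0 → gradient u x ≠ 0 → 0 < u x →
      ‖x‖ ^ α * ‖gradient u x‖ ^ β * u x ^ d ≤ C * pLaplacian p u x) :
    ∃ A > 0, ∀ y : E n, ∀ l R, 0 < l → 0 < R → R ≤ ‖y‖ →
      (∀ x ∈ Metric.ball y R, A * (l ^ (-(d - (p - β - 1))) * R ^ (-(p - β))) ≤ ‖x‖ ^ α) →
      u y ≤ l := by
  have hs : 0 < p - β - 1 := by linarith
  have hq : 0 < d - (p - β - 1) := sub_pos.2 hd
  have hp' : 0 < p - 1 := by linarith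
  obtain ⟨μ, hμ⟩ := exists_gt (max (p / (p - 1)) ((p - β) / (p - β - 1)))
  rw [max_lt_iff, div_lt_iff₀ hs] at hμ
  have hμ0 : 0 < μ := (div_pos (by linarith) hp').trans hμ.1
  obtain ⟨γ, hγ⟩ := exists_gt ((p - β) / (d - (p - β - 1)))
  have hγ0 : 0 < γ := (div_pos (by linarith) hq).trans hγ
  rw [div_lt_iff₀ hq] at hγ
  refine ⟨C * (((p - 1) * ((γ + 1) * μ) + n) * (γ * μ) ^ (p - β - 1)), by positivity,
    fun y l R hl hR hRy hball ↦ h.le_of_forall_ball hp hC.le (hs.trans hd) hsub hμ.1 hγ0 hμ.2.le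
      hγ.le hl hR hRy fun x hx ↦ ?_⟩
  simpa only [mul_assoc] using hball x hx

theorem exists_le_mul_norm_rpow (h : IsPSubharmonicOffZero p u) (hp : 1 < p) (hC : 0 < C)
    (hβ : β < p - 1) (hd : p - β - 1 < d)
    (hsub : ∀ x : E n, x ≠ 0 → gradient u x ≠ 0 → 0 < u x →
      ‖x‖ ^ α * ‖gradient u x‖ ^ β * u x ^ d ≤ C * pLaplacian p u x) :
    ∃ K, ∀ y : E n, y ≠ 0 → u y ≤ K * ‖y‖ ^ (-((p - β + α) / (d - (p - β - 1)))) := by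
  obtain ⟨A, hA, hle⟩ := h.exists_forall_ball_le hp hC hβ hd hsub
  obtain ⟨c, hc, hball⟩ := exists_mul_rpow_le_of_mem_ball n α
  refine ⟨(A * 2 ^ (p - β) / c) ^ (1 / (d - (p - β - 1))), fun y hy ↦ ?_⟩
  have hy0 : 0 < ‖y‖ := norm_pos_iff.2 hy
  refine hle y _ (‖y‖ / 2) (by positivity) (half_pos hy0) (half_le_self hy0.le) fun x hx ↦ ?_
  rw [mul_rpow_neg_mul_half_rpow_neg hA hc (sub_pos.2 hd).ne' hy0]
  exact hball y x hx

theorem eq_zero_of_nonneg (h : IsPSubharmonicOffZero p u) (hp : 1 < p) (hn : 0 < n) (hC : 0 < C)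
    (hα : -1 < α) (hβ : β < p - 1) (hd : p - β - 1 < d)
    (hsub : ∀ x : E n, x ≠ 0 → gradient u x ≠ 0 → 0 < u x →
      ‖x‖ ^ α * ‖gradient u x‖ ^ β * u x ^ d ≤ C * pLaplacian p u x)
    (hnonneg : ∀ x, 0 ≤ u x) (x : E n) : u x = 0 := by
  by_contra hx
  have hx0 : 0 < u x := (hnonneg x).lt_of_ne' hx
  obtain ⟨K, hK⟩ := h.exists_le_mul_norm_rpow hp hC hβ hd hsub
  have hdecay : Tendsto (fun y : E n ↦ K * ‖y‖ ^ (-((p - β + α) / (d - (p - β - 1)))))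
      (cocompact (E n)) (𝓝 0) := by
    simpa using ((tendsto_rpow_neg_atTop (div_pos (by linarith) (sub_pos.2 hd))).comp
      (tendsto_norm_cocompact_atTop (E := E n))).const_mul K
  have hsmall : ∀ᶠ y in cocompact (E n), u y ≤ u x := by
    filter_upwards [hdecay.eventually_le_const hx0, hasBasis_cocompact.mem_of_mem
      (isCompact_singleton (x := (0 : E n)))] with y hy hy0
    exact (hK y hy0).trans hy
  obtain ⟨z, hz⟩ := h.contDiff_one.continuous.exists_forall_ge' x hsmall
  exact h.not_isLocalMax hp hn z (Eventually.of_forall hz)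

end IsPSubharmonicOffZero

theorem IsTraceComparable.le_of_hasNonnegNontrivialSubsolution {cone : Set (Multiset ℝ)}
    {F : Multiset ℝ → ℝ} (hF : IsTraceComparable n cone F) (hp : 1 < p) (hα : -1 < α)
    (hβ : β < p - 1) (h : HasNonnegNontrivialSubsolution n p α β (powerNonlin d) cone F) :
    d ≤ p - β - 1 := by
  by_contra! hd
  obtain ⟨u, hu, hnonneg, z, hz⟩ := h
  have hmem : ∀ x : E n, x ≠ 0 → pHessEigenvalues p u x ∈ cone := fun x hx ↦
    hu.admissible x (Or.inl hx)
  have htrace : ∀ x : E n, x ≠ 0 → (pHessEigenvalues p u x).sum = pLaplacian p u x := fun x hx ↦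
    sum_pHessEigenvalues_eq_pLaplacian (hF.card_eq _ (hmem x hx))
  have hps : IsPSubharmonicOffZero p u :=
    { contDiff_one := hu.regular.contDiff_one
      contDiffOn_two := hu.regular.contDiffOn_two
      differentiableAt_pGrad := fun x hx ↦ (hu.regular.pGrad_contDiffOn.contDiffAt
        (isOpen_compl_singleton.mem_nhds hx)).differentiableAt one_ne_zero
      pLaplacian_pos := fun x hx ↦ htrace x hx ▸ hF.sum_pos _ (hmem x hx) }
  obtain ⟨C, hC, hle⟩ := hF.exists_le_mul_sum
  refine hz (hps.eq_zero_of_nonneg hp hF.dim_pos hC hα hβ hd (fun x hx _ hpos ↦ ?_)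
    hnonneg z)
  calc ‖x‖ ^ α * ‖gradient u x‖ ^ β * u x ^ d
      = ‖x‖ ^ α * ‖gradient u x‖ ^ β * powerNonlin d (u x) := by rw [powerNonlin, if_pos hpos]
    _ ≤ F (pHessEigenvalues p u x) := hu.subsolution x (Or.inl hx)
    _ ≤ C * pLaplacian p u x := htrace x hx ▸ hle _ (hmem x hx)

end Liouville

section ExpPow

variable {F : Type*} [NormedAddCommGroup F] {x : F} {a b s μ : ℝ}

theorem norm_rpow_sub_two (hx : x ≠ 0) (s : ℝ) : ‖x‖ ^ (s - 2) = ‖x‖ ^ s / ‖x‖ ^ 2 :=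
  mod_cast Real.rpow_sub_natCast (norm_ne_zero_iff.2 hx) s 2

theorem tendsto_norm_rpow_zero (hs : 0 < s) : Tendsto (fun x : F ↦ ‖x‖ ^ s) (𝓝 0) (𝓝 0) := by
  have hcont : Continuous fun x : F ↦ ‖x‖ ^ s :=
    continuous_norm.rpow_const fun _ ↦ Or.inr hs.le
  simpa [Real.zero_rpow hs.ne'] using hcont.tendsto 0

/-- The radial function `exp (a |x|^μ)`, a subsolution for suitable `a` and `μ`. -/
def expPow (a μ : ℝ) (x : F) : ℝ := Real.exp (a * ‖x‖ ^ μ)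

theorem expPow_pos (a μ : ℝ) (x : F) : 0 < expPow a μ x := Real.exp_pos _

theorem one_le_expPow (ha : 0 ≤ a) (μ : ℝ) (x : F) : 1 ≤ expPow a μ x :=
  Real.one_le_exp (by positivity)

theorem expPow_rpow (a μ q : ℝ) (x : F) : expPow a μ x ^ q = expPow (a * q) μ x := by
  rw [expPow, expPow, ← Real.exp_mul, mul_right_comm]

theorem norm_norm_rpow_smul [NormedSpace ℝ F] (s : ℝ) (hx : x ≠ 0) :
    ‖‖x‖ ^ s • x‖ = ‖x‖ ^ (s + 1) := by
  rw [norm_smul, Real.norm_of_nonneg (by positivity), Real.rpow_add_one (norm_ne_zero_iff.2 hx)]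

variable [InnerProductSpace ℝ F]

/-- The derivative of the radial field `|x|^s x`. -/
def normRpowSmulDeriv (s : ℝ) (x : F) : F →L[ℝ] F :=
  ‖x‖ ^ s • ContinuousLinearMap.id ℝ F + ((s * ‖x‖ ^ (s - 2)) • innerSL ℝ x).smulRight x

theorem hasFDerivAt_norm_rpow_smul_of_ne (s : ℝ) (hx : x ≠ 0) :
    HasFDerivAt (fun x : F ↦ ‖x‖ ^ s • x) (normRpowSmulDeriv s x) x :=
  (hasFDerivAt_norm_rpow_of_ne hx s).smul (hasFDerivAt_id x)

theorem norm_normRpowSmulDeriv_le (s : ℝ) (hx : x ≠ 0) :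
    ‖normRpowSmulDeriv s x‖ ≤ (1 + |s|) * ‖x‖ ^ s := by
  have hx' : ‖x‖ ≠ 0 := norm_ne_zero_iff.2 hx
  have hid : ‖‖x‖ ^ s • ContinuousLinearMap.id ℝ F‖ ≤ ‖x‖ ^ s := by
    rw [norm_smul, Real.norm_of_nonneg (by positivity)]
    exact mul_le_of_le_one_right (by positivity) ContinuousLinearMap.norm_id_le
  have hrank : ‖((s * ‖x‖ ^ (s - 2)) • innerSL ℝ x).smulRight x‖ = |s| * ‖x‖ ^ s := by
    rw [ContinuousLinearMap.norm_smulRight_apply, norm_smul, innerSL_apply_norm, norm_mul,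
      Real.norm_eq_abs, Real.norm_of_nonneg (by positivity : 0 ≤ ‖x‖ ^ (s - 2)),
      norm_rpow_sub_two hx]
    field_simp
  exact (norm_add_le _ _).trans (by linarith)

theorem normRpowSmulDeriv_zero (hs : s ≠ 0) : normRpowSmulDeriv s (0 : F) = 0 := by
  ext v
  simp [normRpowSmulDeriv, Real.zero_rpow hs]

theorem hasFDerivAt_norm_rpow_smul (hs : 0 < s) (x : F) :
    HasFDerivAt (fun x : F ↦ ‖x‖ ^ s • x) (normRpowSmulDeriv s x) x := by
  obtain rfl | hx := eq_or_ne x 0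
  · rw [normRpowSmulDeriv_zero hs.ne', hasFDerivAt_iff_isLittleO_nhds_zero]
    simpa using ((Asymptotics.isLittleO_one_iff ℝ).2 (tendsto_norm_rpow_zero hs)).smul_isBigO
      (Asymptotics.isBigO_refl (fun x : F ↦ x) (𝓝 0))
  · exact hasFDerivAt_norm_rpow_smul_of_ne s hx

theorem contDiffAt_norm_rpow_smul (s : ℝ) {N : WithTop ℕ∞} (hx : x ≠ 0) :
    ContDiffAt ℝ N (fun x : F ↦ ‖x‖ ^ s • x) x :=
  ((contDiffAt_norm ℝ hx).rpow_const_of_ne (norm_ne_zero_iff.2 hx)).smul contDiffAt_id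

theorem continuous_normRpowSmulDeriv (hs : 0 < s) :
    Continuous (normRpowSmulDeriv s : F → F →L[ℝ] F) := by
  rw [continuous_iff_continuousAt]
  intro x
  obtain rfl | hx := eq_or_ne x 0
  · rw [ContinuousAt, normRpowSmulDeriv_zero hs.ne']
    have hbound : Tendsto (fun x : F ↦ (1 + |s|) * ‖x‖ ^ s) (𝓝 0) (𝓝 0) := by
      simpa using (tendsto_norm_rpow_zero hs).const_mul (1 + |s|)
    refine squeeze_zero_norm (fun x ↦ ?_) hbound
    obtain rfl | hx := eq_or_ne x 0
    · rw [normRpowSmulDeriv_zero hs.ne', norm_zero]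
      positivity
    · exact norm_normRpowSmulDeriv_le s hx
  · have hcont := ((contDiffAt_norm_rpow_smul s (N := 1) hx).fderiv_right (m := 0)
      (by norm_num)).continuousAt
    rwa [show fderiv ℝ _ = normRpowSmulDeriv s from
      funext fun x ↦ (hasFDerivAt_norm_rpow_smul hs x).fderiv] at hcont

theorem contDiff_norm_rpow_smul (hs : 0 ≤ s) : ContDiff ℝ 1 (fun x : F ↦ ‖x‖ ^ s • x) := by
  obtain rfl | hs := hs.eq_or_lt
  · simpa using contDiff_fun_id
  rw [contDiff_one_iff_hasFDerivAt]
  exact ⟨normRpowSmulDeriv s, continuous_normRpowSmulDeriv hs, hasFDerivAt_norm_rpow_smul hs⟩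

theorem hasFDerivAt_expPow (a : ℝ) (hμ : 1 < μ) (x : F) :
    HasFDerivAt (expPow a μ) (expPow a μ x • a • (μ * ‖x‖ ^ (μ - 2)) • innerSL ℝ x) x :=
  ((hasFDerivAt_norm_rpow x hμ).const_mul a).exp

theorem contDiff_expPow (a : ℝ) (hμ : 1 < μ) : ContDiff ℝ 1 (expPow a μ : F → ℝ) :=
  (contDiff_const.mul (contDiff_norm_rpow hμ)).exp

theorem contDiffAt_expPow (a μ : ℝ) {N : WithTop ℕ∞} (hx : x ≠ 0) : ContDiffAt ℝ N (expPow a μ) x :=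
  (contDiffAt_const.mul ((contDiffAt_norm ℝ hx).rpow_const_of_ne (norm_ne_zero_iff.2 hx))).exp

/-- The radial field `exp (b |x|^μ) |x|^s x`; the gradient and the `p`-gradient of `expPow` are
multiples of fields of this form. -/
def expField (b μ s : ℝ) (x : F) : F := expPow b μ x • ‖x‖ ^ s • x

theorem contDiff_expField (b : ℝ) (hμ : 1 < μ) (hs : 0 ≤ s) :
    ContDiff ℝ 1 (expField b μ s : F → F) :=
  (contDiff_expPow b hμ).smul (contDiff_norm_rpow_smul hs)

theorem contDiffAt_expField (b μ s : ℝ) {N : WithTop ℕ∞} (hx : x ≠ 0) :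
    ContDiffAt ℝ N (expField b μ s) x :=
  (contDiffAt_expPow b μ hx).smul (contDiffAt_norm_rpow_smul s hx)

/-- The derivative of `expField` away from the origin. -/
def expFieldDeriv (b μ s : ℝ) (x : F) : F →L[ℝ] F :=
  (expPow b μ x * ‖x‖ ^ s) • (ContinuousLinearMap.id ℝ F +
    ((s + b * μ * ‖x‖ ^ μ) / ‖x‖ ^ 2) • (innerSL ℝ x).smulRight x)

theorem hasFDerivAt_expField (b : ℝ) (hμ : 1 < μ) (s : ℝ) (hx : x ≠ 0) :
    HasFDerivAt (expField b μ s) (expFieldDeriv b μ s x) x := by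
  refine ((hasFDerivAt_expPow b hμ x).smul (hasFDerivAt_norm_rpow_smul_of_ne s hx)).congr_fderiv ?_
  ext1 v
  simp only [expFieldDeriv, normRpowSmulDeriv, add_apply, smul_apply,
    ContinuousLinearMap.smulRight_apply, innerSL_apply_apply, ContinuousLinearMap.id_apply,
    smul_eq_mul, smul_add, smul_smul, add_assoc, ← add_smul,
    norm_rpow_sub_two hx]
  congr 2
  ring

theorem hasFDerivAt_expField_zero (b : ℝ) (hμ : 1 < μ) :
    HasFDerivAt (expField b μ 0) (ContinuousLinearMap.id ℝ F) 0 := by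
  have h := (hasFDerivAt_expPow b hμ (0 : F)).smul (hasFDerivAt_id (0 : F))
  have hfield : expField b μ 0 = (expPow b μ : F → ℝ) • (id : F → F) := by
    ext1 y
    simp [expField]
  rw [hfield]
  simpa [expPow, Real.zero_rpow (by linarith : μ ≠ 0)] using h

theorem inner_expFieldDeriv (b μ s : ℝ) (x v w : F) :
    inner ℝ (expFieldDeriv b μ s x v) w = expPow b μ x * ‖x‖ ^ s *
      (inner ℝ v w + (s + b * μ * ‖x‖ ^ μ) / ‖x‖ ^ 2 * (inner ℝ x v * inner ℝ x w)) := by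
  simp only [expFieldDeriv, add_apply, smul_apply, ContinuousLinearMap.smulRight_apply,
    innerSL_apply_apply, ContinuousLinearMap.id_apply, inner_add_left, real_inner_smul_left]

theorem isSymmetric_expFieldDeriv (b μ s : ℝ) (x : F) :
    (expFieldDeriv b μ s x : F →ₗ[ℝ] F).IsSymmetric := by
  intro v w
  rw [ContinuousLinearMap.coe_coe, real_inner_comm (expFieldDeriv b μ s x w) v,
    inner_expFieldDeriv, inner_expFieldDeriv, real_inner_comm]
  ring

theorem inner_sq_div_norm_sq_le (x v : F) : inner ℝ x v ^ 2 / ‖x‖ ^ 2 ≤ ‖v‖ ^ 2 := by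
  rw [← div_pow, sq_le_sq, abs_div, abs_norm, abs_norm]
  exact div_le_of_le_mul₀ (norm_nonneg x) (norm_nonneg v)
    ((abs_real_inner_le_norm x v).trans_eq (mul_comm _ _))

theorem le_inner_expFieldDeriv (hb : 0 ≤ b) (hμ : 0 ≤ μ) (s : ℝ) (x v : F) :
    expPow b μ x * ‖x‖ ^ s * min 1 (1 + s) * ‖v‖ ^ 2 ≤ inner ℝ (expFieldDeriv b μ s x v) v := by
  set W := inner ℝ x v ^ 2 / ‖x‖ ^ 2 with hW
  have hWv : W ≤ ‖v‖ ^ 2 := inner_sq_div_norm_sq_le x v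
  have hW0 : 0 ≤ W := by positivity
  have hmin : min 1 (1 + s) * ‖v‖ ^ 2 ≤ ‖v‖ ^ 2 + s * W := by
    obtain hs | hs := le_total 0 s
    · rw [min_eq_left (by linarith)]
      linarith [mul_nonneg hs hW0]
    · rw [min_eq_right (by linarith)]
      linarith [mul_le_mul_of_nonpos_left hWv hs]
  have hE := expPow_pos b μ x
  calc expPow b μ x * ‖x‖ ^ s * min 1 (1 + s) * ‖v‖ ^ 2
      = expPow b μ x * ‖x‖ ^ s * (min 1 (1 + s) * ‖v‖ ^ 2) := mul_assoc _ _ _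
    _ ≤ expPow b μ x * ‖x‖ ^ s * (‖v‖ ^ 2 + s * W + b * μ * ‖x‖ ^ μ * W) := by
        gcongr
        exact hmin.trans (le_add_of_nonneg_right (by positivity))
    _ = inner ℝ (expFieldDeriv b μ s x v) v := by
        rw [inner_expFieldDeriv, real_inner_self_eq_norm_sq, hW]
        ring

theorem norm_expFieldDeriv_apply_le (b μ s : ℝ) (x v : F) :
    ‖expFieldDeriv b μ s x v‖ ≤
      expPow b μ x * (1 + |s + b * μ * ‖x‖ ^ μ|) * ‖x‖ ^ s * ‖v‖ := by
  have hE := expPow_pos b μ x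
  have hproj : ‖((s + b * μ * ‖x‖ ^ μ) / ‖x‖ ^ 2) • inner ℝ x v • x‖ ≤
      |s + b * μ * ‖x‖ ^ μ| * ‖v‖ := by
    rw [norm_smul, norm_smul, norm_div, norm_pow, norm_norm, Real.norm_eq_abs, div_mul_eq_mul_div,
      mul_div_assoc]
    refine mul_le_mul_of_nonneg_left (div_le_of_le_mul₀ (by positivity) (norm_nonneg v) ?_)
      (abs_nonneg _)
    calc ‖inner ℝ x v‖ * ‖x‖ ≤ ‖x‖ * ‖v‖ * ‖x‖ := by
          gcongr
          exact norm_inner_le_norm x v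
      _ = ‖v‖ * ‖x‖ ^ 2 := by ring
  calc ‖expFieldDeriv b μ s x v‖
      = expPow b μ x * ‖x‖ ^ s *
          ‖v + ((s + b * μ * ‖x‖ ^ μ) / ‖x‖ ^ 2) • inner ℝ x v • x‖ := by
        rw [expFieldDeriv, smul_apply, norm_smul, Real.norm_of_nonneg (by positivity)]
        rfl
    _ ≤ expPow b μ x * ‖x‖ ^ s * (‖v‖ + |s + b * μ * ‖x‖ ^ μ| * ‖v‖) := by
        gcongr
        exact (norm_add_le _ _).trans (by gcongr)
    _ = expPow b μ x * (1 + |s + b * μ * ‖x‖ ^ μ|) * ‖x‖ ^ s * ‖v‖ := by ring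

variable [CompleteSpace F]

theorem hasGradientAt_expPow (a : ℝ) (hμ : 1 < μ) (x : F) :
    HasGradientAt (expPow a μ) ((a * μ) • expField a μ (μ - 2) x) x := by
  rw [hasGradientAt_iff_hasFDerivAt]
  refine (hasFDerivAt_expPow a hμ x).congr_fderiv ?_
  ext v
  simp only [expField, smul_apply, innerSL_apply_apply, smul_eq_mul,
    InnerProductSpace.toDual_apply_apply, real_inner_smul_left]
  ring

theorem gradient_expPow (a : ℝ) (hμ : 1 < μ) (x : F) :
    gradient (expPow a μ) x = (a * μ) • expField a μ (μ - 2) x :=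
  (hasGradientAt_expPow a hμ x).gradient

theorem norm_gradient_expPow (ha : 0 ≤ a) (hμ : 1 < μ) (hx : x ≠ 0) :
    ‖gradient (expPow a μ) x‖ = a * μ * (expPow a μ x * ‖x‖ ^ (μ - 1)) := by
  rw [gradient_expPow a hμ, expField, norm_smul, norm_smul, norm_norm_rpow_smul _ hx,
    Real.norm_of_nonneg (by positivity), Real.norm_of_nonneg (expPow_pos a μ x).le]
  ring_nf

theorem contDiff_two_expPow (a : ℝ) (hμ : 2 ≤ μ) : ContDiff ℝ 2 (expPow a μ : F → ℝ) := by
  have hfd : fderiv ℝ (expPow a μ : F → ℝ) =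
      fun x ↦ InnerProductSpace.toDual ℝ F ((a * μ) • expField a μ (μ - 2) x) :=
    funext fun x ↦ (hasGradientAt_expPow a (by linarith) x).hasFDerivAt.fderiv
  rw [← one_add_one_eq_two, contDiff_succ_iff_fderiv, hfd]
  exact ⟨(contDiff_expPow a (by linarith)).differentiable one_ne_zero, by simp,
    (InnerProductSpace.toDual ℝ F).contDiff.comp
      ((contDiff_expField a (by linarith) (by linarith)).const_smul (a * μ))⟩

end ExpPow

section ExpPowEigenvalues

variable {n : ℕ} {p a μ : ℝ} {x : E n}

theorem pGrad_expPow (ha : 0 < a) (hμ : 1 < μ) :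
    pGrad p (expPow a μ : E n → ℝ) = fun x ↦
      (a * μ) ^ (p - 1) • expField (a * (p - 1)) μ ((μ - 1) * (p - 1) - 1) x := by
  funext x
  obtain rfl | hx := eq_or_ne x 0
  · simp [pGrad, gradient_expPow a hμ, expField]
  have hr : 0 < ‖x‖ := norm_pos_iff.2 hx
  have haμ : 0 < a * μ := by positivity
  have hE := expPow_pos a μ x
  have hcoeff : (a * μ) ^ (p - 1) = (a * μ) ^ (p - 2) * (a * μ) := by
    rw [← Real.rpow_add_one haμ.ne']
    ring_nf
  have hexp : expPow (a * (p - 1)) μ x = expPow a μ x ^ (p - 2) * expPow a μ x := by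
    rw [← expPow_rpow, ← Real.rpow_add_one hE.ne']
    ring_nf
  have hnorm : ‖x‖ ^ ((μ - 1) * (p - 1) - 1) = ‖x‖ ^ ((μ - 1) * (p - 2)) * ‖x‖ ^ (μ - 2) := by
    rw [← Real.rpow_add hr]
    ring_nf
  rw [pGrad, norm_gradient_expPow ha.le hμ hx, gradient_expPow a hμ, expField, expField, hcoeff,
    hexp, hnorm, Real.mul_rpow haμ.le (by positivity), Real.mul_rpow hE.le (by positivity),
    ← Real.rpow_mul hr.le]
  simp only [smul_smul]
  congr 1
  ring

theorem fderiv_pGrad_expPow (ha : 0 < a) (hμ : 1 < μ) (hx : x ≠ 0) :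
    fderiv ℝ (pGrad p (expPow a μ)) x =
      (a * μ) ^ (p - 1) • expFieldDeriv (a * (p - 1)) μ ((μ - 1) * (p - 1) - 1) x := by
  rw [pGrad_expPow ha hμ]
  exact ((hasFDerivAt_expField _ hμ _ hx).const_smul ((a * μ) ^ (p - 1))).fderiv

theorem fderiv_pGrad_expPow_zero (ha : 0 < a) (hμ : 1 < μ) (hpμ : (μ - 1) * (p - 1) = 1) :
    fderiv ℝ (pGrad p (expPow a μ)) (0 : E n) =
      (a * μ) ^ (p - 1) • ContinuousLinearMap.id ℝ (E n) := by
  rw [pGrad_expPow ha hμ, hpμ, sub_self]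
  exact ((hasFDerivAt_expField_zero _ hμ).const_smul ((a * μ) ^ (p - 1))).fderiv

theorem isSymmetric_fderiv_pGrad_expPow (ha : 0 < a) (hμ : 1 < μ) (hx : x ≠ 0) :
    (fderiv ℝ (pGrad p (expPow a μ)) x : E n →ₗ[ℝ] E n).IsSymmetric := by
  rw [fderiv_pGrad_expPow ha hμ hx]
  exact (isSymmetric_expFieldDeriv _ _ _ x).smul (conj_trivial _)

theorem isSymmetric_fderiv_pGrad_expPow_zero (ha : 0 < a) (hμ : 1 < μ)
    (hpμ : (μ - 1) * (p - 1) = 1) :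
    (fderiv ℝ (pGrad p (expPow a μ)) (0 : E n) : E n →ₗ[ℝ] E n).IsSymmetric := by
  rw [fderiv_pGrad_expPow_zero ha hμ hpμ]
  exact LinearMap.IsSymmetric.id.smul (conj_trivial _)

theorem le_of_mem_pHessEigenvalues_expPow (hp : 1 ≤ p) (ha : 0 < a) (hμ : 1 < μ) (hx : x ≠ 0) :
    ∀ y ∈ pHessEigenvalues p (expPow a μ) x,
      (a * μ) ^ (p - 1) * (expPow a μ x ^ (p - 1) * ‖x‖ ^ ((μ - 1) * (p - 1) - 1)
        * min 1 ((μ - 1) * (p - 1))) ≤ y := by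
  refine le_of_mem_pHessEigenvalues_of_isSymmetric (isSymmetric_fderiv_pGrad_expPow ha hμ hx)
    fun v ↦ ?_
  have h := le_inner_expFieldDeriv (mul_nonneg ha.le (sub_nonneg.2 hp)) (by linarith : 0 ≤ μ)
    ((μ - 1) * (p - 1) - 1) x v
  rw [add_sub_cancel, ← expPow_rpow] at h
  rw [fderiv_pGrad_expPow ha hμ hx, smul_apply, real_inner_smul_left, mul_assoc]
  exact mul_le_mul_of_nonneg_left h (by positivity)

theorem le_of_mem_pHessEigenvalues_expPow_zero (ha : 0 < a) (hμ : 1 < μ)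
    (hpμ : (μ - 1) * (p - 1) = 1) :
    ∀ y ∈ pHessEigenvalues p (expPow a μ) (0 : E n), (a * μ) ^ (p - 1) ≤ y := by
  refine le_of_mem_pHessEigenvalues_of_isSymmetric
    (isSymmetric_fderiv_pGrad_expPow_zero ha hμ hpμ) fun v ↦ ?_
  rw [fderiv_pGrad_expPow_zero ha hμ hpμ, smul_apply, real_inner_smul_left,
    ContinuousLinearMap.id_apply, real_inner_self_eq_norm_sq]

end ExpPowEigenvalues

section WeakDerivative

variable {n : ℕ} {f w : E n → ℝ} {δ : ℝ}

theorem integral_fderiv_single_eq_zero {N : ℕ} {f : (Fin (N + 1) → ℝ) → ℝ}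
    {s : Set (Fin (N + 1) → ℝ)} (hs : s.Countable) (hf : Continuous f) (hsupp : HasCompactSupport f)
    (hd : ∀ x ∉ s, DifferentiableAt ℝ f x) (j : Fin (N + 1))
    (hi : Integrable fun x ↦ fderiv ℝ f x (Pi.single j 1)) :
    ∫ x, fderiv ℝ f x (Pi.single j 1) = 0 := by
  obtain ⟨R, hR0, hR⟩ := hsupp.isBounded.exists_pos_norm_lt
  have hzero : ∀ x i, |x i| = R → f x = 0 := fun x i hx ↦
    image_eq_zero_of_notMem_tsupport fun h ↦ ((norm_le_pi_norm x i).trans_lt (hR x h)).ne hx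
  let S := ContinuousLinearMap.single ℝ (fun _ : Fin (N + 1) ↦ ℝ) j
  have hsum : ∀ x, ∑ i, (S ∘L fderiv ℝ f x) (Pi.single i 1) i = fderiv ℝ f x (Pi.single j 1) := by
    intro x
    simp [S, Pi.single_apply]
  have hdiv := integral_divergence_of_hasFDerivAt_off_countable (fun _ ↦ -R) (fun _ ↦ R)
    (fun _ ↦ by linarith) (fun x ↦ S (f x)) (fun x ↦ S ∘L fderiv ℝ f x) s hs
    (S.continuous.comp hf).continuousOn
    (fun x hx ↦ S.hasFDerivAt.comp x (hd x hx.2).hasFDerivAt)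
    (by simpa only [hsum] using hi.integrableOn)
  have hface : ∀ (i : Fin (N + 1)) (y : Fin N → ℝ) (t : ℝ), |t| = R → S (f (i.insertNth t y)) = 0 :=
    fun i y t ht ↦ by rw [hzero _ i (by simpa using ht), map_zero]
  simp only [hsum, hface _ _ R (abs_of_pos hR0), hface _ _ (-R) (by simp [abs_of_pos hR0]),
    Pi.zero_apply, integral_zero, sub_self, Finset.sum_const_zero] at hdiv
  rw [← hdiv, setIntegral_eq_integral_of_forall_compl_eq_zero]
  intro x hx
  have hx' : x ∉ tsupport f := fun h ↦ hx
    ⟨fun i ↦ neg_le_of_abs_le ((norm_le_pi_norm x i).trans (hR x h).le),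
      fun i ↦ le_of_abs_le ((norm_le_pi_norm x i).trans (hR x h).le)⟩
  rw [fderiv_of_notMem_tsupport (𝕜 := ℝ) hx', zero_apply]

theorem integral_fderiv_single_eq_zero_of_differentiable_off_zero (hf : Continuous f)
    (hsupp : HasCompactSupport f) (hd : ∀ x ≠ 0, DifferentiableAt ℝ f x) (j : Fin n)
    (hi : Integrable fun x ↦ fderiv ℝ f x (EuclideanSpace.single j 1)) :
    ∫ x, fderiv ℝ f x (EuclideanSpace.single j 1) = 0 := by
  obtain ⟨N, rfl⟩ := Nat.exists_eq_add_one_of_ne_zero j.pos.ne'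
  let L : (Fin (N + 1) → ℝ) ≃L[ℝ] E (N + 1) := (EuclideanSpace.equiv (Fin (N + 1)) ℝ).symm
  have hmp : MeasurePreserving L := PiLp.volume_preserving_toLp (Fin (N + 1))
  have hemb : MeasurableEmbedding L := L.toHomeomorph.measurableEmbedding
  have hfd : (fun y ↦ fderiv ℝ f (L y) (EuclideanSpace.single j 1)) =
      fun y ↦ fderiv ℝ (f ∘ L) y (Pi.single j 1) := by
    funext y
    rw [L.comp_right_fderiv]
    rfl
  rw [← hmp.integral_comp hemb, hfd]
  refine integral_fderiv_single_eq_zero (countable_singleton 0) (hf.comp L.continuous)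
    (hsupp.comp_homeomorph L.toHomeomorph) (fun y hy ↦ ?_) j ?_
  · exact (hd _ ((map_ne_zero_iff L L.injective).2 hy)).comp y L.differentiableAt
  · rw [← hfd]
    exact (hmp.integrable_comp_emb hemb).2 hi

theorem isWeakPartial_fderiv_of_differentiable_off_zero (hw : Continuous w)
    (hd : ∀ x ≠ 0, DifferentiableAt ℝ w x) (j : Fin n)
    (hi : LocallyIntegrable fun x ↦ fderiv ℝ w x (EuclideanSpace.single j 1)) :
    IsWeakPartial j w fun x ↦ fderiv ℝ w x (EuclideanSpace.single j 1) := by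
  intro φ hφ hφs
  have hφd : Differentiable ℝ φ := hφ.differentiable (by simp)
  have hφ' : Continuous fun x ↦ fderiv ℝ φ x (EuclideanSpace.single j 1) :=
    (hφ.continuous_fderiv (by simp)).clm_apply continuous_const
  have hne : ∀ᵐ x : E n, x ≠ 0 := by
    have : Nontrivial (E n) := ⟨EuclideanSpace.single j 1, 0, by simp⟩
    exact Measure.ae_ne volume 0
  have hprod : (fun x ↦ fderiv ℝ (w * φ) x (EuclideanSpace.single j 1)) =ᵐ[volume] fun x ↦
      w x * fderiv ℝ φ x (EuclideanSpace.single j 1)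
        + fderiv ℝ w x (EuclideanSpace.single j 1) * φ x := by
    filter_upwards [hne] with x hx
    rw [fderiv_mul (hd x hx) (hφd x), add_apply, smul_apply, smul_apply, smul_eq_mul, smul_eq_mul,
      mul_comm (φ x)]
  have hint : Integrable fun x ↦ w x * fderiv ℝ φ x (EuclideanSpace.single j 1) :=
    (hw.mul hφ').integrable_of_hasCompactSupport
      ((hφs.fderiv_apply (𝕜 := ℝ) (EuclideanSpace.single j 1)).mul_left)
  have hint' : Integrable fun x ↦ fderiv ℝ w x (EuclideanSpace.single j 1) * φ x := by
    simpa only [smul_eq_mul, mul_comm] using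
      hi.integrable_smul_left_of_hasCompactSupport hφ.continuous hφs
  have hzero := integral_fderiv_single_eq_zero_of_differentiable_off_zero (hw.mul hφ.continuous)
    hφs.mul_left (fun x hx ↦ (hd x hx).mul (hφd x)) j
    ((integrable_congr hprod).2 (hint.add hint'))
  rw [integral_congr_ae hprod, integral_add hint hint'] at hzero
  exact eq_neg_of_add_eq_zero_left hzero

theorem memLpLoc_of_abs_le_rpow (hn : 0 < n) (hf : AEStronglyMeasurable f volume) {σ : ℝ}
    (hδ : 0 < δ) (hσ : σ * δ < n)
    (hb : ∀ R, ∃ C, ∀ x ≠ 0, ‖x‖ ≤ R → |f x| ≤ C * ‖x‖ ^ (-σ)) : MemLpLoc f δ := by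
  intro K hK
  obtain ⟨R, -, hR⟩ := hK.isBounded.exists_pos_norm_lt
  obtain ⟨C, hC⟩ := hb R
  have hne : ∀ᵐ x : E n, x ≠ 0 := by
    have : Nontrivial (E n) := ⟨EuclideanSpace.single ⟨0, hn⟩ 1, 0, by simp⟩
    exact Measure.ae_ne volume 0
  have hbound : ∀ᵐ x ∂volume.restrict (Metric.ball (0 : E n) R),
      ‖‖f x‖ ^ δ‖ ≤ C ^ δ * ‖x‖ ^ (-(σ * δ)) := by
    filter_upwards [ae_restrict_of_ae hne, ae_restrict_mem measurableSet_ball] with x hx0 hxR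
    have hx := hC x hx0 (mem_ball_zero_iff.1 hxR).le
    have hr : 0 < ‖x‖ := norm_pos_iff.2 hx0
    have hC0 : 0 ≤ C := nonneg_of_mul_nonneg_left ((abs_nonneg _).trans hx) (by positivity)
    calc ‖‖f x‖ ^ δ‖ = |f x| ^ δ := Real.norm_of_nonneg (by positivity)
      _ ≤ (C * ‖x‖ ^ (-σ)) ^ δ := by gcongr
      _ = C ^ δ * ‖x‖ ^ (-(σ * δ)) := by
          rw [Real.mul_rpow hC0 (by positivity), ← Real.rpow_mul hr.le, neg_mul]
  have hball : IntegrableOn (fun x ↦ ‖f x‖ ^ δ) (Metric.ball 0 R) volume :=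
    integrableOn_ball_of_norm_le_rpow (by simpa using Nat.one_le_iff_ne_zero.2 hn.ne')
      (by simpa using hσ) hbound (hf.norm.aemeasurable.pow_const δ).aestronglyMeasurable
  rw [← integrable_norm_rpow_iff hf.restrict (by simpa using hδ) ENNReal.ofReal_ne_top,
    ENNReal.toReal_ofReal hδ.le]
  exact hball.mono_set fun x hx ↦ mem_ball_zero_iff.2 (hR x hx)

theorem memLpLoc_of_continuous (hf : Continuous f) (δ : ℝ) : MemLpLoc f δ := by
  intro K hK
  have : IsFiniteMeasure (volume.restrict K) := ⟨by simpa using hK.measure_lt_top⟩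
  obtain ⟨C, hC⟩ := hK.exists_bound_of_continuousOn hf.continuousOn
  exact MemLp.of_bound hf.aestronglyMeasurable C <|
    (ae_restrict_iff' hK.measurableSet).2 (.of_forall hC)

theorem MemLpLoc.locallyIntegrable (hδ : 1 ≤ δ) (h : MemLpLoc f δ) : LocallyIntegrable f := by
  rw [locallyIntegrable_iff]
  intro K hK
  have : IsFiniteMeasure (volume.restrict K) := ⟨by simpa using hK.measure_lt_top⟩
  exact (h K hK).integrable (by simpa using hδ)

end WeakDerivative

section ExpPowSobolev

variable {n : ℕ} {a μ δ : ℝ} {x : E n}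

theorem fderiv_expPow_single (a : ℝ) (hμ : 1 < μ) (i : Fin n) :
    (fun x : E n ↦ fderiv ℝ (expPow a μ) x (EuclideanSpace.single i 1)) =
      fun x ↦ a * μ * inner ℝ (EuclideanSpace.single i (1 : ℝ)) (expField a μ (μ - 2) x) := by
  funext x
  rw [(hasGradientAt_expPow a hμ x).fderiv_apply, real_inner_comm, real_inner_smul_right]

theorem hasFDerivAt_fderiv_expPow_single (a : ℝ) (hμ : 1 < μ) (i : Fin n) (hx : x ≠ 0) :
    HasFDerivAt (fun x ↦ fderiv ℝ (expPow a μ) x (EuclideanSpace.single i 1))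
      ((a * μ) • (innerSL ℝ (EuclideanSpace.single i (1 : ℝ))).comp
        (expFieldDeriv a μ (μ - 2) x)) x := by
  rw [fderiv_expPow_single a hμ i]
  exact ((innerSL ℝ (EuclideanSpace.single i (1 : ℝ))).hasFDerivAt.comp x
    (hasFDerivAt_expField a hμ (μ - 2) hx)).const_mul (a * μ)

theorem abs_fderiv_fderiv_expPow_single_le (a : ℝ) (hμ : 1 < μ) (i j : Fin n) (hx : x ≠ 0) :
    |fderiv ℝ (fun x ↦ fderiv ℝ (expPow a μ) x (EuclideanSpace.single i 1)) x
        (EuclideanSpace.single j 1)| ≤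
      |a * μ| * (expPow a μ x * (1 + |μ - 2 + a * μ * ‖x‖ ^ μ|)) * ‖x‖ ^ (μ - 2) := by
  have hcoord := abs_real_inner_le_norm (EuclideanSpace.single i (1 : ℝ))
    (expFieldDeriv a μ (μ - 2) x (EuclideanSpace.single j 1))
  have hnorm := norm_expFieldDeriv_apply_le a μ (μ - 2) x (EuclideanSpace.single j 1)
  rw [PiLp.norm_single, norm_one, one_mul] at hcoord
  rw [PiLp.norm_single, norm_one, mul_one] at hnorm
  rw [(hasFDerivAt_fderiv_expPow_single a hμ i hx).fderiv, smul_apply,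
    ContinuousLinearMap.comp_apply, innerSL_apply_apply, smul_eq_mul, abs_mul, mul_assoc |a * μ|]
  exact mul_le_mul_of_nonneg_left (hcoord.trans hnorm) (abs_nonneg _)

theorem memLpLoc_fderiv_fderiv_expPow_single (a : ℝ) (hμ : 1 < μ) (hδ : 0 < δ)
    (hμδ : (2 - μ) * δ < n) (i j : Fin n) :
    MemLpLoc (fun x ↦ fderiv ℝ (fun x ↦ fderiv ℝ (expPow a μ) x (EuclideanSpace.single i 1)) x
      (EuclideanSpace.single j 1)) δ := by
  refine memLpLoc_of_abs_le_rpow i.pos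
    (measurable_fderiv_apply_const ℝ _ _).aestronglyMeasurable hδ hμδ fun R ↦ ?_
  have hcont : Continuous fun x : E n ↦
      |a * μ| * (expPow a μ x * (1 + |μ - 2 + a * μ * ‖x‖ ^ μ|)) := by
    have hpow : Continuous fun x : E n ↦ ‖x‖ ^ μ :=
      continuous_norm.rpow_const fun _ ↦ Or.inr (by linarith)
    have hexp : Continuous (expPow a μ : E n → ℝ) := (contDiff_expPow a hμ).continuous
    fun_prop
  obtain ⟨C, hC⟩ := (isCompact_closedBall (0 : E n) R).exists_bound_of_continuousOn
    hcont.continuousOn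
  refine ⟨C, fun x hx hxR ↦ (abs_fderiv_fderiv_expPow_single_le a hμ i j hx).trans ?_⟩
  rw [neg_sub]
  gcongr
  exact (le_abs_self _).trans (hC x (mem_closedBall_zero_iff.2 hxR))

theorem memW2Loc_expPow (a : ℝ) (hμ : 1 < μ) (hδ : 1 < δ) (hμδ : (2 - μ) * δ < n) :
    MemW2Loc (expPow a μ : E n → ℝ) δ := by
  have hu : ContDiff ℝ 1 (expPow a μ : E n → ℝ) := contDiff_expPow a hμ
  have hg : ∀ i : Fin n,
      Continuous fun x : E n ↦ fderiv ℝ (expPow a μ) x (EuclideanSpace.single i 1) :=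
    fun i ↦ (hu.continuous_fderiv one_ne_zero).clm_apply continuous_const
  have hH := memLpLoc_fderiv_fderiv_expPow_single (n := n) a hμ (by linarith) hμδ
  refine ⟨memLpLoc_of_continuous hu.continuous δ, _, _,
    fun i ↦ ⟨memLpLoc_of_continuous (hg i) δ, ?_⟩, fun i j ↦ ⟨hH i j, ?_⟩⟩
  · exact isWeakPartial_fderiv_of_differentiable_off_zero hu.continuous
      (fun x _ ↦ (hu.differentiable one_ne_zero).differentiableAt) i (hg i).locallyIntegrable
  · exact isWeakPartial_fderiv_of_differentiable_off_zero (hg i)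
      (fun x hx ↦ (hasFDerivAt_fderiv_expPow_single a hμ i hx).differentiableAt) j
      ((hH i j).locallyIntegrable hδ.le)

end ExpPowSobolev

section Existence

variable {n : ℕ} {p α β d a μ : ℝ} {cone : Set (Multiset ℝ)} {F : Multiset ℝ → ℝ}

theorem exists_expPow_parameters (hp : 1 < p) (hα : -1 < α) (hβ : β < p - 1) :
    ∃ a μ : ℝ, 0 < a ∧ 1 < μ ∧ (μ - 1) * (p - β - 1) = α + 1 ∧
      1 ≤ (a * μ) ^ (p - β - 1) * min 1 ((μ - 1) * (p - 1)) := by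
  have hγ : 0 < p - β - 1 := by linarith
  have hμ : 0 < (α + 1) / (p - β - 1) := div_pos (by linarith) hγ
  set μ := 1 + (α + 1) / (p - β - 1) with hμ_def
  set κ := min 1 ((μ - 1) * (p - 1))
  have hκ : 0 < κ := lt_min one_pos (mul_pos (by linarith) (by linarith))
  refine ⟨κ⁻¹ ^ (p - β - 1)⁻¹ / μ, μ, by positivity, by linarith, ?_, ?_⟩
  · rw [hμ_def, add_sub_cancel_left, div_mul_cancel₀ _ hγ.ne']
  · rw [div_mul_cancel₀ _ (by positivity), Real.rpow_inv_rpow (by positivity) hγ.ne',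
      inv_mul_cancel₀ hκ.ne']

theorem entireRegularity_expPow (hn : 0 < n) (hβ : β < p - 1) (ha : 0 < a) (hμ : 1 < μ)
    (hμα : (μ - 1) * (p - β - 1) = α + 1) :
    EntireRegularity p α β (expPow a μ : E n → ℝ) where
  contDiff_one := contDiff_expPow a hμ
  contDiffOn_two := fun x hx ↦ (contDiffAt_expPow a μ hx).contDiffWithinAt
  contDiff_two := fun h ↦ contDiff_two_expPow a (by nlinarith)
  sobolev := fun h _ δ hδ hδ' ↦ by
    refine memW2Loc_expPow a hμ hδ (lt_of_lt_of_le ?_ (Nat.one_le_cast.2 hn))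
    rw [lt_div_iff₀ (by linarith)] at hδ'
    refine lt_of_mul_lt_mul_right (a := p - β - 1) ?_ (by linarith)
    calc (2 - μ) * δ * (p - β - 1) = δ * (p - α - β - 2) := by linear_combination -δ * hμα
      _ < 1 * (p - β - 1) := by rwa [one_mul]
  pGrad_contDiffOn := by
    rw [pGrad_expPow ha hμ]
    exact fun x hx ↦ ((contDiffAt_expField _ _ _ hx).const_smul _).contDiffWithinAt
  pGrad_contDiff := fun h ↦ by
    have hexp : ((μ - 1) * (p - 1) - 1) * (p - β - 1) = (p - 1) * α + β := by
      linear_combination (p - 1) * hμα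
    rw [pGrad_expPow ha hμ]
    exact (contDiff_expField _ hμ
      (nonneg_of_mul_nonneg_left (hexp ▸ h) (by linarith))).const_smul _

theorem norm_rpow_mul_norm_gradient_expPow_rpow_mul_le {x : E n} (ha : 0 < a) (hμ : 1 < μ)
    (hμα : (μ - 1) * (p - β - 1) = α + 1)
    (haμ : 1 ≤ (a * μ) ^ (p - β - 1) * min 1 ((μ - 1) * (p - 1))) (hd : d ≤ p - β - 1)
    (hx : x ≠ 0) :
    ‖x‖ ^ α * ‖gradient (expPow a μ) x‖ ^ β * expPow a μ x ^ d ≤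
      (a * μ) ^ (p - 1) * (expPow a μ x ^ (p - 1) * ‖x‖ ^ ((μ - 1) * (p - 1) - 1)
        * min 1 ((μ - 1) * (p - 1))) := by
  have hr : 0 < ‖x‖ := norm_pos_iff.2 hx
  have hA : 0 < a * μ := by positivity
  have hu : 0 < expPow a μ x := expPow_pos a μ x
  have hsplit : ∀ {t : ℝ}, 0 < t → t ^ (p - 1) = t ^ β * t ^ (p - β - 1) := fun ht ↦ by
    rw [← Real.rpow_add ht]
    ring_nf
  have hnorm : ‖x‖ ^ ((μ - 1) * (p - 1) - 1) = ‖x‖ ^ α * ‖x‖ ^ ((μ - 1) * β) := by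
    rw [← Real.rpow_add hr]
    congr 1
    linear_combination hμα
  rw [norm_gradient_expPow ha.le hμ hx, Real.mul_rpow hA.le (by positivity),
    Real.mul_rpow hu.le (by positivity), ← Real.rpow_mul hr.le, hsplit hA, hsplit hu, hnorm]
  set lhs := ‖x‖ ^ α * ((a * μ) ^ β * (expPow a μ x ^ β * ‖x‖ ^ ((μ - 1) * β)))
  calc lhs * expPow a μ x ^ d
      ≤ lhs * expPow a μ x ^ (p - β - 1) := by
        gcongr
        exact one_le_expPow ha.le μ x
    _ ≤ lhs * expPow a μ x ^ (p - β - 1)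
        * ((a * μ) ^ (p - β - 1) * min 1 ((μ - 1) * (p - 1))) :=
        le_mul_of_one_le_right (by positivity) haμ
    _ = _ := by ring

namespace IsTraceComparable

theorem expPow_admissible_and_subsolution (hF : IsTraceComparable n cone F) (hp : 1 < p)
    (ha : 0 < a) (hμ : 1 < μ) (hμα : (μ - 1) * (p - β - 1) = α + 1)
    (haμ : 1 ≤ (a * μ) ^ (p - β - 1) * min 1 ((μ - 1) * (p - 1))) (hd : d ≤ p - β - 1)
    {x : E n} (hx : x ≠ 0) :
    pHessEigenvalues p (expPow a μ) x ∈ cone ∧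
      ‖x‖ ^ α * ‖gradient (expPow a μ) x‖ ^ β * expPow a μ x ^ d ≤
        F (pHessEigenvalues p (expPow a μ) x) := by
  have _ : 0 < ‖x‖ := norm_pos_iff.2 hx
  have hu := expPow_pos a μ x
  have _ : 0 < min 1 ((μ - 1) * (p - 1)) := lt_min one_pos (by nlinarith)
  have hcard := card_pHessEigenvalues_of_isSymmetric
    (isSymmetric_fderiv_pGrad_expPow (p := p) ha hμ hx)
  have hle := le_of_mem_pHessEigenvalues_expPow hp.le ha hμ hx
  exact ⟨hF.mem_of_forall_le _ (by positivity) _ hcard hle,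
    (norm_rpow_mul_norm_gradient_expPow_rpow_mul_le ha hμ hμα haμ hd hx).trans
      (hF.le_of_forall_le _ (by positivity) _ hcard hle)⟩

theorem expPow_admissible_and_subsolution_zero (hF : IsTraceComparable n cone F)
    (ha : 0 < a) (hμ : 1 < μ) (hpμ : (μ - 1) * (p - 1) = 1) (haμ : 1 ≤ (a * μ) ^ (p - 1)) :
    pHessEigenvalues p (expPow a μ) (0 : E n) ∈ cone ∧
      ‖(0 : E n)‖ ^ (0 : ℝ) * ‖gradient (expPow a μ) (0 : E n)‖ ^ (0 : ℝ)
        * expPow a μ (0 : E n) ^ d ≤ F (pHessEigenvalues p (expPow a μ) (0 : E n)) := by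
  have hcard := card_pHessEigenvalues_of_isSymmetric
    (isSymmetric_fderiv_pGrad_expPow_zero (n := n) ha hμ hpμ)
  have hle := le_of_mem_pHessEigenvalues_expPow_zero (n := n) ha hμ hpμ
  refine ⟨hF.mem_of_forall_le _ (by positivity) _ hcard hle,
    le_trans ?_ (hF.le_of_forall_le _ (by positivity) _ hcard hle)⟩
  simpa [expPow, Real.zero_rpow (by linarith : μ ≠ 0)] using haμ

theorem isEntireAdmissibleSubsolution_expPow (hF : IsTraceComparable n cone F) (hp : 1 < p)
    (hβ : β < p - 1) (ha : 0 < a) (hμ : 1 < μ) (hμα : (μ - 1) * (p - β - 1) = α + 1)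
    (haμ : 1 ≤ (a * μ) ^ (p - β - 1) * min 1 ((μ - 1) * (p - 1))) (hd : d ≤ p - β - 1) :
    IsEntireAdmissibleSubsolution p α β (powerNonlin d) cone F (expPow a μ : E n → ℝ) := by
  have hmain : ∀ x : E n, (x ≠ 0 ∨ (α = 0 ∧ β = 0)) →
      pHessEigenvalues p (expPow a μ) x ∈ cone ∧
        ‖x‖ ^ α * ‖gradient (expPow a μ) x‖ ^ β * expPow a μ x ^ d ≤
          F (pHessEigenvalues p (expPow a μ) x) := by
    intro x hx
    obtain rfl | hx0 := eq_or_ne x 0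
    · obtain ⟨rfl, rfl⟩ := hx.resolve_left (not_not_intro rfl)
      have hpμ : (μ - 1) * (p - 1) = 1 := by linarith
      exact hF.expPow_admissible_and_subsolution_zero ha hμ hpμ (by simpa [hpμ] using haμ)
    · exact hF.expPow_admissible_and_subsolution hp ha hμ hμα haμ hd hx0
  refine ⟨entireRegularity_expPow hF.dim_pos hβ ha hμ hμα, fun x hx ↦ (hmain x hx).1,
    fun x hx _ _ ↦ ?_, fun x hx ↦ ?_⟩
  · have _ : 0 < ‖x‖ := norm_pos_iff.2 hx
    have hu := expPow_pos a μ x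
    rw [← norm_pos_iff, norm_gradient_expPow ha.le hμ hx]
    positivity
  · rw [powerNonlin, if_pos (expPow_pos a μ x)]
    exact (hmain x hx).2

theorem hasNonnegNontrivialSubsolution (hF : IsTraceComparable n cone F) (hp : 1 < p)
    (hα : -1 < α) (hβ : β < p - 1) (hd : d ≤ p - β - 1) :
    HasNonnegNontrivialSubsolution n p α β (powerNonlin d) cone F := by
  obtain ⟨a, μ, ha, hμ, hμα, haμ⟩ := exists_expPow_parameters hp hα hβ
  exact ⟨expPow a μ, hF.isEntireAdmissibleSubsolution_expPow hp hβ ha hμ hμα haμ hd,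
    fun x ↦ (expPow_pos a μ x).le, 0, (expPow_pos a μ 0).ne'⟩

theorem hasNonnegNontrivialSubsolution_iff (hF : IsTraceComparable n cone F) (hp : 1 < p)
    (hα : -1 < α) (hβ : β < p - 1) :
    HasNonnegNontrivialSubsolution n p α β (powerNonlin d) cone F ↔ d ≤ p - β - 1 :=
  ⟨hF.le_of_hasNonnegNontrivialSubsolution hp hα hβ,
    hF.hasNonnegNontrivialSubsolution hp hα hβ⟩

end IsTraceComparable

theorem ExponentCondition.neg_one_lt {c : ℝ} (hc : -1 < c) (h : ExponentCondition c p α β) :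
    -1 < α :=
  h.elim (fun h ↦ hc.trans_le h.1) And.left

end Existence

end HessianSub

end

theorem corollary1p2_general (n k : ℕ) (hk : 1 ≤ k) (hkn : k ≤ n) (p α β d : ℝ)
    (hp : 1 < p) (hα : -1 < α) (hβ : β < p - 1) :
    (HessianSub.HasNonnegNontrivialSubsolution n p α β (HessianSub.powerNonlin d)
        (HessianSub.gardingCone n k) (HessianSub.hessOp k) ↔ d ≤ p - β - 1) ∧
    (HessianSub.HasNonnegNontrivialSubsolution n p α β (HessianSub.powerNonlin d)
        (HessianSub.sumCone n k) (HessianSub.piOp n k) ↔ d ≤ p - β - 1) :=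
  ⟨(HessianSub.isTraceComparable_hessOp hk hkn).hasNonnegNontrivialSubsolution_iff hp hα hβ,
    (HessianSub.isTraceComparable_piOp hk hkn).hasNonnegNontrivialSubsolution_iff hp hα hβ⟩

theorem corollary1p2 (n k : ℕ) (hk : 1 ≤ k) (hkn : k ≤ n) (p α β d : ℝ)
    (hp : 1 < p) (hβ : β < p - 1) (hd : 0 ≤ d) :
    (HessianSub.ExponentCondition (1 / (k : ℝ) - 1) p α β →
      (HessianSub.HasNonnegNontrivialSubsolution n p α β (HessianSub.powerNonlin d)
          (HessianSub.gardingCone n k) (HessianSub.hessOp k) ↔ d ≤ p - β - 1)) ∧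
    (HessianSub.ExponentCondition ((k : ℝ) / (n : ℝ) - 1) p α β →
      (HessianSub.HasNonnegNontrivialSubsolution n p α β (HessianSub.powerNonlin d)
          (HessianSub.sumCone n k) (HessianSub.piOp n k) ↔ d ≤ p - β - 1)) := by
  have hk0 : (0 : ℝ) < k := mod_cast hk
  have hn0 : (0 : ℝ) < n := mod_cast hk.trans hkn
  exact ⟨fun h ↦ (corollary1p2_general n k hk hkn p α β d hp
      (h.neg_one_lt (by linarith [one_div_pos.2 hk0])) hβ).1,
    fun h ↦ (corollary1p2_general n k hk hkn p α β d hp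
      (h.neg_one_lt (by linarith [div_pos hk0 hn0])) hβ).2⟩
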